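/- Graphs are finite and may have parallel edges (but no loops); a cycle has length at least $2$, a $2$-cycle being a pair of parallel edges. For a simple graph $G$, $\mu G$ denotes the multigraph obtained by replacing each edge of $G$ by $\mu$ parallel edges. Let $\lambda, n, m$ be positive integers, let $V(\lambda m K_n)=\{0,\dots,n-1\}$, and let $V_0,\dots,V_{n-1}$ be the parts, each of size $m$, of the complete equipartite multigraph $\lambda K_{n\times m}$. Definitions. A decomposition of $G$ is a family of subgraphs whose edge sets partition $E(G)$. A cycle decomposition $\{C_1,\dots,C_k\}$ of $G$ is a decomposition of $G$ into the cycles $C_1,\dots,C_k$, or, in case all degrees of $G$ are odd, into $C_1,\dots,C_k$ and a single $1$-factor; it is a $(c_1,\dots,c_k)$-cycle decomposition if each $C_i$ has length $c_i$. An $r$-factor is a spanning $r$-regular subgraph; an almost $r$-factor of $G$ is an $r$-factor of $G-v$ for some vertex $v$; a holey $r$-factor of $\lambda K_{n\times m}$ is an $r$-factor of $\lambda K_{n\times m}-V_j$ for some $j$. A cycle decomposition is $[\alpha_1,\dots,\alpha_\ell]$-resolvable if its cycles can be partitioned into $\ell$ classes such that the union of the cycles of the $j$-th class is a $2\alpha_j$-factor,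 for each $j$. A $2$-factorization is a decomposition into $2$-factors, or, if $G$ is regular of odd degree, into $2$-factors and a single $1$-factor; an almost (holey) $2$-factorization is a decomposition into almost (holey) $2$-factors. It has type $[T_1,\dots,T_\ell]$ if its (almost, holey) $2$-factors are $F_1,\dots,F_\ell$ and $F_s$ is a disjoint union of cycles whose multiset of lengths is $T_s$, for each $s$. A cycle decomposition is equivalent to such a factorization if its cycles can be partitioned into $\ell$ classes so that $F_s$ is the union of the cycles of the $s$-th class. For a multiset $T$ of integers, $mT=[mx : x\in T]$. Let $\mathcal D=\{C_1,\dots,C_k\}$ be a cycle decomposition of $\lambda m K_n$. Then there is a cycle decomposition $\mathcal D'=\{C_1',\dots,C_k'\}$ of $\lambda K_{n\times m}$ with $$V(C_i')=\bigcup_{j\in V(C_i)}V_j\qquad\text{for all } i\in\{1,\dots,k\},$$ and every such $\mathcal D'$ has the following properties. (i) If $\mathcal D$ is a $(c_1,\dots,c_k)$-cycle decomposition, then $\mathcal D'$ is a $(c_1m,\dots,c_km)$-cycle decomposition. (ii) If $\mathcal D$ is $[\alpha_1,\dots,\alpha_\ell]$-resolvable, then $\mathcal D'$ is $[\alpha_1,\dots,\alpha_\ell]$-resolvable.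 (iii) If $\mathcal D$ is equivalent to a $2$-factorization of type $[T_1,\dots,T_\ell]$, then $\mathcal D'$ is equivalent to a $2$-factorization of type $[mT_1,\dots,mT_\ell]$. (iv) If $\mathcal D$ is equivalent to an almost $2$-factorization of type $[T_1,\dots,T_\ell]$, then $\mathcal D'$ is equivalent to a holey $2$-factorization of type $[mT_1,\dots,mT_\ell]$. -/

import Mathlib

open scoped Graph

namespace CycleDecomp

variable {α β ι κ : Type*}

/-- The degree of a vertex of a multigraph (a loop would count twice). -/
noncomputable def deg (G : Graph α β) (x : α) : ℕ :=
  (G.incidenceSet x).ncard + (G.loopSet x).ncard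

/-- Every vertex of `G` has degree `r`. -/
def IsRegular (r : ℕ) (G : Graph α β) : Prop :=
  ∀ x ∈ V(G), deg G x = r

/-- The `μ`-fold graph `μ G`: every edge of the simple graph `G` is replaced by `μ` parallel
edges, which carry the labels in `Fin μ`. -/
def fold {W : Type*} (μ : ℕ) (G : SimpleGraph W) : Graph W (Sym2 W × Fin μ) where
  vertexSet := Set.univ
  IsLink e x y := G.Adj x y ∧ e.1 = s(x, y)
  isLink_symm _ _ := { symm := fun _ _ h => ⟨h.1.symm, h.2.trans Sym2.eq_swap⟩ }
  eq_or_eq_of_isLink_of_isLink _ x y v w h h' := by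
    have h2 : s(x, y) = s(v, w) := h.2.symm.trans h'.2
    rcases Sym2.eq_iff.1 h2 with h3 | h3
    · exact Or.inl h3.1
    · exact Or.inr h3.1
  left_mem_of_isLink _ _ _ _ := Set.mem_univ _

/-- The complete `μ`-fold graph `μ K_n` with vertex set `Fin n`. -/
def completeMulti (μ n : ℕ) : Graph (Fin n) (Sym2 (Fin n) × Fin μ) :=
  fold μ (⊤ : SimpleGraph (Fin n))

/-- The complete `lam`-fold equipartite graph `lam K_{n × m}` with `n` parts of size `m`. -/
def equipartite (lam n m : ℕ) : Graph (Fin n × Fin m) (Sym2 (Fin n × Fin m) × Fin lam) :=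
  fold lam (SimpleGraph.completeEquipartiteGraph n m)

/-- The part `V_j` of `lam K_{n × m}`. -/
def part (n m : ℕ) (j : Fin n) : Set (Fin n × Fin m) := {x | x.1 = j}

/-- The multigraph `H` is a cycle with `c ≥ 2` vertices
`v 0, v 1, …, v (c - 1)` and `c` edges, the edge `e i` joining `v i` and `v (i + 1)`, indices
modulo `c`. For `c = 2` this is a pair of parallel edges. -/
def IsCycleOfLength (c : ℕ) (H : Graph α β) : Prop :=
  2 ≤ c ∧ ∃ (v : ZMod c → α) (e : ZMod c → β), v.Injective ∧ e.Injective ∧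
    V(H) = Set.range v ∧ E(H) = Set.range e ∧ ∀ i, H.IsLink (e i) (v i) (v (i + 1))

/-- `H` is a cycle. -/
def IsCycle (H : Graph α β) : Prop := ∃ c, IsCycleOfLength c H

/-- The subgraphs `H i` form a decomposition of `G`: the set `E(G)` is partitioned into the sets
`E(H i)`. -/
def IsDecomposition (G : Graph α β) (H : ι → Graph α β) : Prop :=
  (∀ i, H i ≤ G) ∧ (Pairwise fun i j => Disjoint E(H i) E(H j)) ∧ E(G) = ⋃ i, E(H i)

/-- `F` is an `r`-factor of `G`: a spanning `r`-regular subgraph. -/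
def IsFactor (r : ℕ) (G F : Graph α β) : Prop :=
  F ≤s G ∧ IsRegular r F

/-- `F` is an almost `r`-factor of `G`: an `r`-factor of `G - v` for some vertex `v` of `G`. -/
def IsAlmostFactor (r : ℕ) (G F : Graph α β) : Prop :=
  ∃ v ∈ V(G), IsFactor r (G.deleteVerts {v}) F

/-- `F` is a holey `r`-factor of `lam K_{n × m}`: an `r`-factor of `lam K_{n × m} - W` for some
part `W`. -/
def IsHoleyFactor (r lam n m : ℕ) (F : Graph (Fin n × Fin m) (Sym2 (Fin n × Fin m) × Fin lam)) :
    Prop :=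
  ∃ j : Fin n, IsFactor r ((equipartite lam n m).deleteVerts (part n m j)) F

/-- The subgraphs `H i` together with a single 1-factor of `G` form a decomposition of `G`. -/
def IsDecompositionWithOneFactor (G : Graph α β) (H : ι → Graph α β) : Prop :=
  ∃ I : Graph α β, IsFactor 1 G I ∧ IsDecomposition G (fun o : Option ι => o.elim I H)

/-- The family `C` of cycles is a cycle decomposition of `G`: the cycles decompose `G`, or,
in case every vertex of `G` is of odd degree, the cycles together with a single 1-factor
decompose `G`. The 1-factor is not listed in the family. -/
def IsCycleDecomposition (G : Graph α β) (C : ι → Graph α β) : Prop :=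
  (∀ i, IsCycle (C i)) ∧
    (IsDecomposition G C ∨
      ((∀ x ∈ V(G), Odd (deg G x)) ∧ IsDecompositionWithOneFactor G C))

/-- The family `C` is a cycle decomposition of `G` in which `C i` has length `c i`, that is, a
`(c_1, …, c_k)`-cycle decomposition. -/
def IsCycleDecompositionOfLengths (G : Graph α β) (C : ι → Graph α β) (c : ι → ℕ) : Prop :=
  IsCycleDecomposition G C ∧ ∀ i, IsCycleOfLength (c i) (C i)

/-- The subgraph `⋃_{i ∈ P} H i` of `G`, for subgraphs `H i` of `G`. -/
def unionIn (G : Graph α β) (H : ι → Graph α β) (P : Set ι) : Graph α β where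
  vertexSet := ⋃ i ∈ P, V(H i)
  IsLink e x y := G.IsLink e x y ∧ ∃ i ∈ P, (H i).IsLink e x y
  isLink_symm _ _ :=
    { symm := fun _ _ h => ⟨h.1.symm, h.2.imp fun _ hi => ⟨hi.1, hi.2.symm⟩⟩ }
  eq_or_eq_of_isLink_of_isLink _ _ _ _ _ h h' := h.1.left_eq_or_eq h'.1
  left_mem_of_isLink _ x _ h := by
    obtain ⟨i, hi, hl⟩ := h.2
    exact Set.mem_biUnion hi hl.left_mem

/-- The cycle decomposition `C` of `G` is `[a_1, …, a_ℓ]`-resolvable: its cycles can be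
partitioned into `ℓ` parallel classes such that the union of the cycles in the `j`-th class is a
`2 a_j`-factor of `G`. The class of `C i` is recorded as `p i`. -/
def IsResolvable {l : ℕ} (G : Graph α β) (C : ι → Graph α β) (a : Fin l → ℕ) : Prop :=
  ∃ p : ι → Fin l, ∀ j, IsFactor (2 * a j) G (unionIn G C {i | p i = j})

/-- The graph `F` is of type `T = [c_1, …, c_t]`: it is a disjoint union of `t` cycles of lengths
`c_1, …, c_t`. -/
def HasType (F : Graph α β) (T : Multiset ℕ) : Prop :=
  ∃ (t : ℕ) (c : Fin t → ℕ) (H : Fin t → Graph α β),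
    T = Multiset.map c Finset.univ.val ∧
    (∀ i, H i ≤ F ∧ IsCycleOfLength (c i) (H i)) ∧
    (Pairwise fun i j => Disjoint V(H i) V(H j)) ∧
    F = unionIn F H Set.univ

/-- `F` is a 2-factorization of `G` of type `[T_1, …, T_ℓ]`: the 2-factors `F s` of type `T s`
decompose `G`, or, when `G` is regular of odd degree, they decompose `G` together with a single
1-factor. -/
def IsTwoFactorizationOfType {l : ℕ} (G : Graph α β) (F : Fin l → Graph α β)
    (T : Fin l → Multiset ℕ) : Prop :=
  (∀ s, IsFactor 2 G (F s) ∧ HasType (F s) (T s)) ∧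
    (IsDecomposition G F ∨
      ((∃ d, Odd d ∧ IsRegular d G) ∧ IsDecompositionWithOneFactor G F))

/-- `F` is an almost 2-factorization of `G` of type `[T_1, …, T_ℓ]`. -/
def IsAlmostTwoFactorizationOfType {l : ℕ} (G : Graph α β) (F : Fin l → Graph α β)
    (T : Fin l → Multiset ℕ) : Prop :=
  (∀ s, IsAlmostFactor 2 G (F s) ∧ HasType (F s) (T s)) ∧ IsDecomposition G F

/-- `F` is a holey 2-factorization of `lam K_{n × m}` of type `[T_1, …, T_ℓ]`. -/
def IsHoleyTwoFactorizationOfType {l : ℕ} (lam n m : ℕ)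
    (F : Fin l → Graph (Fin n × Fin m) (Sym2 (Fin n × Fin m) × Fin lam))
    (T : Fin l → Multiset ℕ) : Prop :=
  (∀ s, IsHoleyFactor 2 lam n m (F s) ∧ HasType (F s) (T s)) ∧
    IsDecomposition (equipartite lam n m) F

/-- The cycle decomposition `C` of `G` corresponds (is equivalent) to the decomposition of `G`
into the 2-regular subgraphs `F s`: the cycles can be partitioned so that each `F s` is the union
of the cycles in the `s`-th class. -/
def CorrespondsTo (G : Graph α β) (C : ι → Graph α β) (F : κ → Graph α β) : Prop :=
  ∃ p : ι → κ, ∀ s, F s = unionIn G C {i | p i = s}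

/-- `C'` is a cycle decomposition of `lam K_{n × m}` that is detached from the family `C` of
cycles of `lam m K_n`: it has one cycle for each cycle of `C`, and
`V(C' i) = ⋃_{j ∈ V(C i)} V_j` for every `i`. -/
def IsDetached {lam n m : ℕ} (C : ι → Graph (Fin n) (Sym2 (Fin n) × Fin (lam * m)))
    (C' : ι → Graph (Fin n × Fin m) (Sym2 (Fin n × Fin m) × Fin lam)) : Prop :=
  IsCycleDecomposition (equipartite lam n m) C' ∧ ∀ i, V(C' i) = ⋃ j ∈ V(C i), part n m j

end CycleDecomp

open CycleDecomp

/-! The existence proof is by amalgamation and detachment. Replace every edge of λmK_n by m parallel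
edges and read each vertex as m vertices of its part glued together: the result is an amalgamation
of λK_{n×m}, coloured by the members of the decomposition. A cycle has become an m-fold cycle,
connected and of degree 2m at vertices of weight m. Undo the gluing one vertex at a time, so that
every colour degree and every edge multiplicity is divided in proportion to weight and the cycle
colours stay connected. In the end such a colour is connected and 2-regular on the union of the
relevant parts, hence a single cycle; a leftover 1-factor only has to keep its degrees.

One splitting (`IsAmalgamation.exists_split`) chooses which darts (half-edges) move to the new
vertex. The balanced choice comes from Hall's theorem in fractional form
(`exists_balanced_selection`). Connectedness survives if no component left after deleting the split
vertex loses all its darts to it; this can be arranged because an even colour class has no bridge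
(`IsAmalgamation.exists_ne_of_even`). `IsAmalgamation.exists_decomposition` turns the final dart
system back into graphs.

Properties (i)-(iv) hold for every detached decomposition because lengths, degrees and spanned sets
of unions of cycles depend only on which vertices lie on which cycles, and this incidence is pulled
back along the projection to parts. -/

namespace CycleDecomp

/-! ### Balanced selection via Hall's theorem -/

/-- A fractional matching saturating the left side yields a matching inside its support. -/
theorem exists_injective_of_fractional_matching {ι σ : Type*} [Fintype ι] [Fintype σ]
    (w : ι → σ → ℚ) (h0 : ∀ i s, 0 ≤ w i s) (hrow : ∀ i, ∑ s, w i s = 1)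
    (hcol : ∀ s, ∑ i, w i s ≤ 1) :
    ∃ f : ι → σ, f.Injective ∧ ∀ i, 0 < w i (f i) := by
  classical
  obtain ⟨f, hf, hf'⟩ := (Finset.all_card_le_biUnion_card_iff_exists_injective
    (fun i : ι => Finset.univ.filter fun s => 0 < w i s)).1 (by
      intro A
      set N := A.biUnion fun i : ι => Finset.univ.filter fun s => 0 < w i s with hN
      -- `N` contains the support of every row in `A`, so weighing `A × N` by rows and by columns
      -- yields Hall's condition.
      have h1 : ∀ i ∈ A, ∑ s ∈ N, w i s = 1 := by
        intro i hi
        rw [← hrow i]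
        refine Finset.sum_subset (Finset.subset_univ _) fun s _ hs => ?_
        by_contra hne
        exact hs (Finset.mem_biUnion.2 ⟨i, hi, by
          simpa using lt_of_le_of_ne (h0 i s) (Ne.symm hne)⟩)
      have h2 : (A.card : ℚ) ≤ N.card := by
        calc (A.card : ℚ) = ∑ i ∈ A, ∑ s ∈ N, w i s := by
              rw [Finset.sum_congr rfl h1]; simp
          _ = ∑ s ∈ N, ∑ i ∈ A, w i s := Finset.sum_comm
          _ ≤ ∑ s ∈ N, 1 := Finset.sum_le_sum fun s _ =>
              (Finset.sum_le_sum_of_subset_of_nonneg (Finset.subset_univ _)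
                fun i _ _ => h0 i s).trans (hcol s)
          _ = N.card := by simp
      exact_mod_cast h2)
  exact ⟨f, hf, fun i => by simpa using hf' i⟩

/-- Among elements coloured by `a` and by `b`, with colour classes of sizes divisible by `g`, one
can select a `1/g` fraction of every `a`-class and of every `b`-class without exhausting
any of the prescribed `q`-classes, which refine the `a`-classes and have at least two elements. -/
theorem exists_balanced_selection {S J B Q : Type*} [Fintype S] [Fintype J] [Fintype B]
    [DecidableEq S] [DecidableEq J] [DecidableEq B] [DecidableEq Q] (g : ℕ) (hg : 2 ≤ g)
    (a : S → J) (b : S → B) (q : S → Q) (R : Set Q) (d : J → ℕ) (t : B → ℕ)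
    (ha : ∀ j, (Finset.univ.filter fun s => a s = j).card = d j * g)
    (hb : ∀ y, (Finset.univ.filter fun s => b s = y).card = t y * g)
    (hq : ∀ s s', q s = q s' → a s = a s')
    (hR : ∀ s, q s ∈ R → 2 ≤ (Finset.univ.filter fun s' => q s' = q s).card) :
    ∃ I : Finset S, (∀ j, (I.filter fun s => a s = j).card = d j) ∧
      (∀ y, (I.filter fun s => b s = y).card = t y) ∧
      ∀ s, q s ∈ R → ∃ s', s' ∉ I ∧ q s' = q s := by
  classical
  have hg0 : (0 : ℚ) < g := by exact_mod_cast (by omega : 0 < g)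
  have hg2 : (2 : ℚ) ≤ g := by exact_mod_cast hg
  set N : Q → ℕ := fun r => (Finset.univ.filter fun s' => q s' = r).card with hN
  set Rj : J → Finset Q := fun j =>
    (Finset.univ.filter fun s => a s = j ∧ q s ∈ R).image q with hRj
  -- The share of `s` spent on reserving one unselected element of its `q`-class. It is at most 1/2
  -- by `hR`, and 1/g ≤ 1/2, so the leftover `1 - 1/g - c s` is nonnegative.
  set c : S → ℚ := fun s => if q s ∈ R then 1 / (N (q s) : ℚ) else 0 with hc
  have hNpos : ∀ s, (0 : ℚ) < N (q s) := fun s => by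
    exact_mod_cast Finset.card_pos.2 ⟨s, by simp⟩
  have hRjmem : ∀ {j r}, r ∈ Rj j → ∃ s, a s = j ∧ q s ∈ R ∧ q s = r := by
    intro j r hr
    simpa [hRj, and_assoc] using hr
  have hc0 : ∀ s, 0 ≤ 1 - 1 / (g : ℚ) - c s := by
    intro s
    have h1 : 1 / (g : ℚ) ≤ 1 / 2 := one_div_le_one_div_of_le (by norm_num) hg2
    have h2 : c s ≤ 1 / 2 := by
      by_cases h : q s ∈ R
      · simp only [hc, if_pos h]
        exact one_div_le_one_div_of_le (by norm_num) (by exact_mod_cast hR s h)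
      · simp only [hc, if_neg h]; norm_num
    linarith
  have hcsum : ∀ j, ∑ s ∈ Finset.univ.filter (fun s => a s = j), c s = (Rj j).card := by
    intro j
    have h1 : ∑ s ∈ Finset.univ.filter (fun s => a s = j), c s
        = ∑ s ∈ Finset.univ.filter (fun s => a s = j ∧ q s ∈ R), 1 / (N (q s) : ℚ) := by
      rw [← Finset.filter_filter, Finset.sum_filter (fun s => q s ∈ R)]
    rw [h1, ← Finset.sum_fiberwise_of_maps_to (t := Rj j) (g := q)
      (fun s hs => Finset.mem_image_of_mem q hs), Finset.card_eq_sum_ones, Nat.cast_sum]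
    refine Finset.sum_congr rfl fun r hr => ?_
    obtain ⟨s, hs, hsR, rfl⟩ := hRjmem hr
    have h2 : (Finset.univ.filter (fun s' => a s' = j ∧ q s' ∈ R)).filter
        (fun s' => q s' = q s) = Finset.univ.filter fun s' => q s' = q s := by
      ext s'
      simp only [Finset.mem_filter, Finset.mem_univ, true_and, and_iff_right_iff_imp]
      intro h
      exact ⟨(hq _ _ h).trans hs, h ▸ hsR⟩
    rw [h2, Finset.sum_congr rfl (g := fun _ => 1 / (N (q s) : ℚ))
      (fun s' hs' => by rw [(Finset.mem_filter.1 hs').2]), Finset.sum_const, nsmul_eq_mul]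
    have := hNpos s
    change (N (q s) : ℚ) * _ = _
    field_simp
    norm_num
  have hsum : ∀ j, ∑ s ∈ Finset.univ.filter (fun s => a s = j), (1 - 1 / (g : ℚ) - c s)
      = d j * (g - 1) - (Rj j).card := by
    intro j
    rw [Finset.sum_sub_distrib, hcsum, Finset.sum_const, ha, nsmul_eq_mul]
    push_cast
    field_simp
  -- Summing the nonnegative leftovers over an `a`-class shows that the truncated subtraction in `r`
  -- below is exact.
  have hle : ∀ j, (Rj j).card ≤ d j * (g - 1) := by
    intro j
    have h1 := Finset.sum_nonneg (s := Finset.univ.filter (fun s => a s = j)) fun s _ => hc0 s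
    rw [hsum] at h1
    have h2 : ((g - 1 : ℕ) : ℚ) = g - 1 := by rw [Nat.cast_sub (by omega)]; simp
    have h3 : ((Rj j).card : ℚ) ≤ (d j * (g - 1) : ℕ) := by rw [Nat.cast_mul, h2]; linarith
    exact_mod_cast h3
  set r : J → ℕ := fun j => d j * (g - 1) - (Rj j).card with hr
  have hrc : ∀ j, (r j : ℚ) = d j * (g - 1) - (Rj j).card := by
    intro j
    rw [hr, Nat.cast_sub (hle j), Nat.cast_mul, Nat.cast_sub (by omega)]; simp
  -- The slots to be matched into `S`: `t y` selected places for each `b`-class, and `d j * (g - 1)`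
  -- unselected places for each `a`-class, one of them reserved for each relevant `q`-class and `r
  -- j` of them free. Spreading each slot uniformly (the free ones in proportion to the leftovers)
  -- loads `s` with at most 1/g, `c s` and `1 - 1/g - c s` respectively, hence at most 1 in total.
  let w : (Σ y, Fin (t y)) ⊕ (Σ j, (Rj j) ⊕ Fin (r j)) → S → ℚ := fun i s =>
    i.elim (fun y => if b s = y.1 then 1 / ((t y.1 : ℚ) * g) else 0)
      fun z => z.2.elim (fun ρ => if q s = ρ.1 then 1 / (N ρ.1 : ℚ) else 0)
        fun _ => if a s = z.1 then (1 - 1 / (g : ℚ) - c s) / r z.1 else 0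
  obtain ⟨f, hf, hfw⟩ := exists_injective_of_fractional_matching w (by
    rintro (⟨y, i⟩ | ⟨j, ρ | i⟩) s
    · simp only [w, Sum.elim_inl]; split_ifs <;> positivity
    · simp only [w, Sum.elim_inl, Sum.elim_inr]; split_ifs <;> positivity
    · simp only [w, Sum.elim_inr]
      split_ifs
      · exact div_nonneg (hc0 s) (by positivity)
      · exact le_rfl) (by
    rintro (⟨y, i⟩ | ⟨j, ρ | i⟩)
    · simp only [w, Sum.elim_inl]
      rw [← Finset.sum_filter, Finset.sum_const, hb, nsmul_eq_mul]
      have : (0 : ℚ) < t y := by exact_mod_cast i.pos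
      push_cast
      field_simp
    · simp only [w, Sum.elim_inl, Sum.elim_inr]
      obtain ⟨s, -, -, hs⟩ := hRjmem ρ.2
      have := hNpos s
      rw [hs] at this
      rw [← Finset.sum_filter, Finset.sum_const, nsmul_eq_mul]
      change (N ρ.1 : ℚ) * _ = _
      field_simp
    · simp only [w, Sum.elim_inr]
      have : (0 : ℚ) < r j := by exact_mod_cast i.pos
      rw [← Finset.sum_filter, ← Finset.sum_div, hsum, ← hrc]
      field_simp) (by
    intro s
    rw [Fintype.sum_sum_type, Fintype.sum_sigma, Fintype.sum_sigma]
    simp only [w, Sum.elim_inl, Sum.elim_inr, Fintype.sum_sum_type, Finset.sum_const,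
      Finset.card_univ, Fintype.card_fin, nsmul_eq_mul, Finset.sum_add_distrib]
    have h1 : ∑ y, (t y : ℚ) * (if b s = y then 1 / ((t y : ℚ) * g) else 0) = 1 / g := by
      rw [Finset.sum_eq_single (b s)]
      · have h0 : 0 < t (b s) * g := by
          rw [← hb]; exact Finset.card_pos.2 ⟨s, by simp⟩
        have h0' : (0 : ℚ) < t (b s) := by exact_mod_cast Nat.pos_of_mul_pos_right h0
        rw [if_pos rfl]; field_simp
      · intro y _ hy; rw [if_neg (Ne.symm hy), mul_zero]
      · simp
    have h2 : ∑ j, ∑ ρ : Rj j, (if q s = ρ.1 then 1 / (N ρ.1 : ℚ) else 0) ≤ c s := by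
      have h3 : ∀ j, ∑ ρ : Rj j, (if q s = ρ.1 then 1 / (N ρ.1 : ℚ) else 0)
          = if q s ∈ Rj j then 1 / (N (q s) : ℚ) else 0 := by
        intro j
        rw [Finset.sum_coe_sort (Rj j) fun ρ => if q s = ρ then 1 / (N ρ : ℚ) else 0,
          Finset.sum_ite_eq]
      simp only [h3]
      rw [Finset.sum_eq_single (a s)]
      · by_cases h : q s ∈ Rj (a s)
        · obtain ⟨s', -, h4, h5⟩ := hRjmem h
          rw [h5] at h4
          simp only [hc, if_pos h, if_pos h4, le_refl]
        · rw [if_neg h]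
          simp only [hc]
          split_ifs <;> positivity
      · intro j _ hj
        refine if_neg fun h => hj ?_
        obtain ⟨s', h4, -, h5⟩ := hRjmem h
        exact h4.symm.trans (hq _ _ h5)
      · simp
    have h3 : ∑ j, (r j : ℚ) * (if a s = j then (1 - 1 / (g : ℚ) - c s) / r j else 0)
        ≤ 1 - 1 / (g : ℚ) - c s := by
      rw [Finset.sum_eq_single (a s)]
      · rw [if_pos rfl]
        by_cases h : (r (a s) : ℚ) = 0
        · rw [h, zero_mul]; exact hc0 s
        · rw [mul_div_cancel₀ _ h]
      · intro y _ hy; rw [if_neg (Ne.symm hy), mul_zero]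
      · simp
    linarith)
  have hfb : ∀ z : Σ y, Fin (t y), b (f (.inl z)) = z.1 := by
    intro z
    by_contra h
    exact lt_irrefl (0 : ℚ) ((hfw (.inl z)).trans_eq (if_neg h))
  have hfq : ∀ j (ρ : Rj j), q (f (.inr ⟨j, .inl ρ⟩)) = ρ.1 := by
    intro j ρ
    by_contra h
    exact lt_irrefl (0 : ℚ) ((hfw (.inr ⟨j, .inl ρ⟩)).trans_eq (if_neg h))
  have hfa : ∀ z : Σ j, (Rj j) ⊕ Fin (r j), a (f (.inr z)) = z.1 := by
    rintro ⟨j, ρ | i⟩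
    · obtain ⟨s, h1, -, h2⟩ := hRjmem ρ.2
      exact (hq _ _ ((hfq j ρ).trans h2.symm)).trans h1
    · by_contra h
      exact lt_irrefl (0 : ℚ) ((hfw (.inr ⟨j, .inr i⟩)).trans_eq (if_neg h))
  set I : Finset S := Finset.univ.image fun z => f (.inl z) with hI
  have hnI : ∀ z, f (.inr z) ∉ I := by
    intro z hz
    obtain ⟨z', -, h⟩ := Finset.mem_image.1 hz
    exact Sum.inl_ne_inr (hf h)
  have hIb : ∀ y, (I.filter fun s => b s = y).card = t y := by
    intro y
    have : (I.filter fun s => b s = y) = Finset.univ.image fun i : Fin (t y) => f (.inl ⟨y, i⟩) := by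
      ext s
      simp only [hI, Finset.mem_filter, Finset.mem_image, Finset.mem_univ, true_and]
      constructor
      · rintro ⟨⟨⟨y', i⟩, rfl⟩, h⟩
        rw [hfb] at h
        subst h
        exact ⟨i, rfl⟩
      · rintro ⟨i, rfl⟩
        exact ⟨⟨_, rfl⟩, hfb _⟩
    rw [this, Finset.card_image_of_injective, Finset.card_univ, Fintype.card_fin]
    intro i i' h
    simpa using hf h
  -- The unselected slots occupy `d j * (g - 1)` of the `d j * g` elements of the class, which
  -- leaves at most `d j` for `I`.
  have hIa : ∀ j, (I.filter fun s => a s = j).card ≤ d j := by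
    intro j
    set A := Finset.univ.image fun z : (Rj j) ⊕ Fin (r j) => f (.inr ⟨j, z⟩) with hA
    have hAc : A.card = d j * (g - 1) := by
      rw [hA, Finset.card_image_of_injective, Finset.card_univ, Fintype.card_sum,
        Fintype.card_coe, Fintype.card_fin]
      · have := hle j
        simp only [hr]; omega
      · intro i i' h
        simpa using hf h
    have hdisj : Disjoint (I.filter fun s => a s = j) A := by
      rw [Finset.disjoint_right]
      intro s hs hs'
      obtain ⟨z, -, rfl⟩ := Finset.mem_image.1 hs
      exact hnI _ (Finset.mem_filter.1 hs').1
    have hsub : (I.filter fun s => a s = j) ∪ A ⊆ Finset.univ.filter fun s => a s = j := by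
      refine Finset.union_subset (Finset.filter_subset_filter _ (Finset.subset_univ _)) ?_
      intro s hs
      obtain ⟨z, -, rfl⟩ := Finset.mem_image.1 hs
      simpa using hfa ⟨j, z⟩
    have h1 := Finset.card_le_card hsub
    rw [Finset.card_union_of_disjoint hdisj, hAc, ha] at h1
    obtain ⟨g', rfl⟩ : ∃ g', g = g' + 1 := ⟨g - 1, by omega⟩
    rw [Nat.add_sub_cancel, Nat.mul_succ] at h1
    omega
  refine ⟨I, ?_, hIb, ?_⟩
  -- Only upper bounds are known per class, but both sides have the same total, so every bound is
  -- attained.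
  · have h1 : ∑ j, (I.filter fun s => a s = j).card = I.card :=
      (Finset.card_eq_sum_card_fiberwise (f := a) (t := Finset.univ) (by simp)).symm
    have h2 : I.card = ∑ y, t y := by
      rw [Finset.card_eq_sum_card_fiberwise (f := b) (t := Finset.univ) (by simp)]
      exact Finset.sum_congr rfl fun y _ => hIb y
    have h3 : (∑ y, t y) * g = (∑ j, d j) * g := by
      rw [Finset.sum_mul, Finset.sum_mul]
      simp only [← ha, ← hb]
      rw [← Finset.card_eq_sum_card_fiberwise (f := b) (t := Finset.univ) (by simp),
        ← Finset.card_eq_sum_card_fiberwise (f := a) (t := Finset.univ) (by simp)]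
    have h4 := Nat.eq_of_mul_eq_mul_right (by omega) h3
    have h5 := (Finset.sum_eq_sum_iff_of_le fun j _ => hIa j).1 (h1.trans (h2.trans h4))
    exact fun j => h5 j (Finset.mem_univ j)
  · intro s hs
    exact ⟨f (.inr ⟨a s, .inl ⟨q s, Finset.mem_image_of_mem q (by simpa using hs)⟩⟩),
      hnI _, hfq _ _⟩

/-- A finite set closed under a fixed-point-free involution has even cardinality. -/
theorem even_card_of_involution {D : Type*} [DecidableEq D] (A : Finset D) (f : D → D)
    (hf : ∀ d ∈ A, f d ∈ A) (hff : ∀ d ∈ A, f (f d) = d) (hne : ∀ d ∈ A, f d ≠ d) :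
    Even A.card := by
  have h : ∑ _d ∈ A, (1 : ZMod 2) = 0 :=
    Finset.sum_involution (fun d _ => f d) (fun _ _ => by decide) (fun d hd _ => hne d hd)
      (fun d hd => hf d hd) (fun d hd => hff d hd)
  rw [Finset.sum_const, nsmul_eq_mul, mul_one] at h
  exact (ZMod.natCast_eq_zero_iff_even).1 h

/-! ### Splitting amalgamated vertices -/

section Detachment

variable {X V D J : Type*} [Fintype X] [DecidableEq X] [Fintype D] [DecidableEq D]
  [DecidableEq J]

/-- An edge-coloured multigraph on `X`, given by its darts `D` (with reversal `rev`, heads `h` and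
colours `c`), which arises from `lam K_{n × m}` by amalgamating vertices within parts: `x` stands
for `w x` vertices of the part `π x`. Every vertex of part `v` has degree `δ j v` in colour `j`,
and the colour classes in `Z` are connected. -/
structure IsAmalgamation (π : X → V) (rev : D → D) (c : D → J) (lam : ℕ) (δ : J → V → ℕ)
    (Z : Set J) (w : X → ℕ) (h : D → X) : Prop where
  ne : ∀ d, π (h d) ≠ π (h (rev d))
  mult : ∀ x y, π x ≠ π y →
    (Finset.univ.filter fun d => h d = x ∧ h (rev d) = y).card = lam * w x * w y
  degree : ∀ j x, (Finset.univ.filter fun d => c d = j ∧ h d = x).card = δ j (π x) * w x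
  connected : ∀ j ∈ Z, ∀ P : X → Prop, (∀ d, c d = j → (P (h d) ↔ P (h (rev d)))) →
    ∀ x y, δ j (π x) ≠ 0 → δ j (π y) ≠ 0 → w x ≠ 0 → w y ≠ 0 → (P x ↔ P y)

variable {π : X → V} {rev : D → D} {c : D → J} {lam : ℕ} {δ : J → V → ℕ} {Z : Set J}
  {w : X → ℕ} {h : D → X}

/-- Adjacency in colour `j` after deleting the vertex `x₀`. -/
def adjAvoiding (rev : D → D) (c : D → J) (h : D → X) (x₀ : X) (j : J) (x y : X) : Prop :=
  ∃ d, c d = j ∧ h d = x ∧ h (rev d) = y ∧ x ≠ x₀ ∧ y ≠ x₀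

/-- A colour class with even degrees has no bridge: each component left after deleting `x₀` is
joined to `x₀` by at least two edges. -/
theorem IsAmalgamation.exists_ne_of_even (H : IsAmalgamation π rev c lam δ Z w h)
    (hrev : rev.Involutive) (hc : ∀ d, c (rev d) = c d) {j : J} (hj : ∀ v, Even (δ j v))
    {s : D} (hs : c s = j) :
    ∃ s', s' ≠ s ∧ c s' = j ∧ h s' = h s ∧
      Relation.EqvGen (adjAvoiding rev c h (h s) j) (h (rev s)) (h (rev s')) := by
  classical
  by_contra hcon
  push Not at hcon
  have hloop : ∀ d, h d ≠ h (rev d) := fun d e => H.ne d (congrArg π e)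
  -- `U` is the component of the far end of `s` once `h s` is deleted. Its degree sum in colour `j`
  -- is even.
  set U : Finset X := Finset.univ.filter fun x => x ≠ h s ∧
    Relation.EqvGen (adjAvoiding rev c h (h s) j) (h (rev s)) x with hU
  set A : Finset D := Finset.univ.filter fun d => c d = j ∧ h d ∈ U with hA
  have hAeven : Even A.card := by
    rw [Finset.card_eq_sum_card_fiberwise (f := h) (t := U)
      (fun d hd => (Finset.mem_filter.1 hd).2.2)]
    refine Finset.even_sum _ fun x hx => ?_
    have : A.filter (fun d => h d = x) = Finset.univ.filter fun d => c d = j ∧ h d = x := by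
      ext d
      simp only [hA, Finset.mem_filter, Finset.mem_univ, true_and]
      exact ⟨fun h' => ⟨h'.1.1, h'.2⟩, fun h' => ⟨⟨h'.1, h'.2 ▸ hx⟩, h'.2⟩⟩
    rw [this, H.degree]
    exact (hj _).mul_right _
  have hrs : rev s ∈ A := by
    simp only [hA, hU, Finset.mem_filter, Finset.mem_univ, true_and]
    exact ⟨(hc s).trans hs, (hloop s).symm, Relation.EqvGen.refl _⟩
  -- If `s` were the only dart of colour `j` from its vertex into `U`, reversal would pair off all
  -- darts at `U` except `rev s`, making the degree sum odd.
  have hE : Even (A.erase (rev s)).card := by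
    refine even_card_of_involution _ rev ?_ (fun d _ => hrev d)
      (fun d _ e => hloop d (by rw [e]))
    intro d hd
    rw [Finset.mem_erase] at hd
    obtain ⟨hd1, hd2⟩ := hd
    simp only [hA, hU, Finset.mem_filter, Finset.mem_univ, true_and] at hd2
    obtain ⟨hdj, hds, hde⟩ := hd2
    have hne : h (rev d) ≠ h s := by
      intro e
      have : rev d = s := by
        by_contra hn
        exact hcon (rev d) hn ((hc d).trans hdj) e (by rwa [hrev d])
      exact hd1 (by rw [← this, hrev d])
    rw [Finset.mem_erase]
    refine ⟨fun e => hds (by rw [hrev.injective e]), ?_⟩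
    simp only [hA, hU, Finset.mem_filter, Finset.mem_univ, true_and]
    exact ⟨(hc d).trans hdj, hne, hde.trans _ _ _
      (Relation.EqvGen.rel _ _ ⟨d, hdj, rfl, rfl, hds, hne⟩)⟩
  rw [Finset.card_erase_of_mem hrs] at hE
  have hpos : 0 < A.card := Finset.card_pos.2 ⟨_, hrs⟩
  obtain ⟨p, hp⟩ := hAeven
  obtain ⟨p', hp'⟩ := hE
  omega

variable [DecidableEq V] [Fintype J]

/-- One vertex can be split off from an amalgamated vertex of weight at least two. -/
theorem IsAmalgamation.exists_split (H : IsAmalgamation π rev c lam δ Z w h)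
    (hrev : rev.Involutive) (hc : ∀ d, c (rev d) = c d) (hZ : ∀ j ∈ Z, ∀ v, Even (δ j v))
    {x₀ x₁ : X} (h0 : 2 ≤ w x₀) (h1 : w x₁ = 0) (hπ : π x₁ = π x₀) :
    ∃ h' : D → X, (∀ d, π (h' d) = π (h d)) ∧
      IsAmalgamation π rev c lam δ Z
        (Function.update (Function.update w x₀ (w x₀ - 1)) x₁ 1) h' := by
  classical
  have hx : x₀ ≠ x₁ := by rintro rfl; omega
  have hloop : ∀ d, h d ≠ h (rev d) := fun d e => H.ne d (congrArg π e)
  have hnx1 : ∀ d, h d ≠ x₁ := by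
    intro d hd
    have h2 := H.degree (c d) x₁
    rw [h1, mul_zero, Finset.card_eq_zero] at h2
    exact Finset.notMem_empty d (h2 ▸ by simp [hd])
  let comp : J → X → Set X := fun j x =>
    {y | Relation.EqvGen (adjAvoiding rev c h x₀ j) x y}
  have hcomp : ∀ j x y, comp j x = comp j y → Relation.EqvGen (adjAvoiding rev c h x₀ j) x y := by
    intro j x y e
    have : y ∈ comp j y := Relation.EqvGen.refl y
    rw [← e] at this
    exact this
  have hcomp' : ∀ j x y, Relation.EqvGen (adjAvoiding rev c h x₀ j) x y → comp j x = comp j y := by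
    intro j x y e
    ext z
    exact ⟨fun hz => (e.symm _ _).trans _ _ _ hz, fun hz => e.trans _ _ _ hz⟩
  -- One of the `w x₀` vertices glued at `x₀` is split off, so a `1 / w x₀` fraction of its darts is
  -- selected, by colour and by far end. Far ends in the same part do not occur, hence the value 0.
  -- The `q`-classes pair a colour with a component after deleting `x₀`; for colours in `Z` each has
  -- two darts since there are no bridges.
  obtain ⟨I, hIa, hIb, hIR⟩ := exists_balanced_selection (S := {d : D // h d = x₀}) (J := J)
    (B := X) (w x₀) h0 (fun s => c s.1) (fun s => h (rev s.1))
    (fun s => (c s.1, comp (c s.1) (h (rev s.1)))) {p | p.1 ∈ Z} (fun j => δ j (π x₀))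
    (fun y => if π x₀ = π y then 0 else lam * w y)
    (by
      intro j
      rw [← H.degree j x₀, ← Finset.card_map (Function.Embedding.subtype _)]
      congr 1
      ext d
      simp)
    (by
      intro y
      split_ifs with hy
      · rw [zero_mul, Finset.card_eq_zero, Finset.filter_eq_empty_iff]
        rintro ⟨d, rfl⟩ _ rfl
        exact H.ne d hy
      · rw [mul_right_comm, ← H.mult x₀ y hy, ← Finset.card_map (Function.Embedding.subtype _)]
        congr 1
        ext d
        simp [and_comm])
    (fun s s' e => congrArg Prod.fst e)
    (by
      rintro ⟨s, rfl⟩ hsZ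
      obtain ⟨s', hne, hs', hhs, hcs⟩ := H.exists_ne_of_even hrev hc (hZ (c s) hsZ) rfl
      refine Finset.one_lt_card.2 ⟨⟨s, rfl⟩, by simp, ⟨s', hhs⟩, ?_, ?_⟩
      · simp only [Finset.mem_filter, Finset.mem_univ, true_and]
        rw [hs', hcomp' _ _ _ hcs]
      · intro e
        exact hne (congrArg Subtype.val e).symm)
  let K : Finset D := I.map (Function.Embedding.subtype _)
  have hK : ∀ d ∈ K, h d = x₀ := by
    intro d hd
    obtain ⟨s, -, rfl⟩ := Finset.mem_map.1 hd
    exact s.2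
  have hKr : ∀ d ∈ K, rev d ∉ K := fun d hd hd' => hloop d ((hK d hd).trans (hK _ hd').symm)
  have hKj : ∀ j, (K.filter fun d => c d = j).card = δ j (π x₀) := by
    intro j
    rw [← hIa j, ← Finset.card_map (Function.Embedding.subtype _)]
    congr 1
    ext d
    simp [K]
  have hKy : ∀ y, π x₀ ≠ π y → (K.filter fun d => h (rev d) = y).card = lam * w y := by
    intro y hy
    have h2 := hIb y
    rw [if_neg hy] at h2
    rw [← h2, ← Finset.card_map (Function.Embedding.subtype _)]
    congr 1
    ext d
    simp [K]
  have hKZ : ∀ d, h d = x₀ → c d ∈ Z → ∃ d', h d' = x₀ ∧ d' ∉ K ∧ c d' = c d ∧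
      Relation.EqvGen (adjAvoiding rev c h x₀ (c d)) (h (rev d')) (h (rev d)) := by
    intro d hd hdZ
    obtain ⟨⟨d', hd'⟩, hdI, e⟩ := hIR ⟨d, hd⟩ hdZ
    have e1 : c d' = c d := congrArg Prod.fst e
    have e2 : comp (c d') (h (rev d')) = comp (c d) (h (rev d)) := congrArg Prod.snd e
    refine ⟨d', hd', fun hm => hdI ?_, e1, hcomp _ _ _ (by rw [← e2, e1])⟩
    obtain ⟨s, hs, rfl⟩ := Finset.mem_map.1 hm
    exact hs
  set h' : D → X := fun d => if d ∈ K then x₁ else h d with hh'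
  have hin : ∀ d ∈ K, h' d = x₁ := fun d hd => if_pos hd
  have hout : ∀ d, d ∉ K → h' d = h d := fun d hd => if_neg hd
  have hπ' : ∀ d, π (h' d) = π (h d) := by
    intro d
    by_cases hd : d ∈ K
    · rw [hin d hd, hK d hd, hπ]
    · rw [hout d hd]
  set w' := Function.update (Function.update w x₀ (w x₀ - 1)) x₁ 1 with hw'
  have hw0 : w' x₀ = w x₀ - 1 := by rw [hw', Function.update_of_ne hx, Function.update_self]
  have hw1 : w' x₁ = 1 := by rw [hw', Function.update_self]
  have hwo : ∀ x, x ≠ x₀ → x ≠ x₁ → w' x = w x := fun x e0 e1 => by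
    rw [hw', Function.update_of_ne e1, Function.update_of_ne e0]
  have h'0 : ∀ d, h' d = x₀ ↔ d ∉ K ∧ h d = x₀ := by
    intro d
    by_cases hd : d ∈ K
    · simp [hin d hd, hd, hx.symm]
    · simp [hout d hd, hd]
  have h'1 : ∀ d, h' d = x₁ ↔ d ∈ K := by
    intro d
    by_cases hd : d ∈ K
    · simp [hin d hd, hd]
    · simp [hout d hd, hd, hnx1]
  have h'o : ∀ x, x ≠ x₀ → x ≠ x₁ → ∀ d, h' d = x ↔ h d = x := by
    intro x e0 e1 d
    by_cases hd : d ∈ K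
    · simp [hin d hd, hK d hd, e0.symm, e1.symm]
    · simp [hout d hd]
  -- The case where the first vertex lies in the affected part; the opposite direction follows by
  -- reversing darts.
  have hmult0 : ∀ x y, π x = π x₀ → π y ≠ π x₀ →
      (Finset.univ.filter fun d => h' d = x ∧ h' (rev d) = y).card = lam * w' x * w' y := by
    intro x y hxp hyp
    have hy0 : y ≠ x₀ := fun e => hyp (congrArg π e)
    have hy1 : y ≠ x₁ := fun e => hyp ((congrArg π e).trans hπ)
    simp only [h'o y hy0 hy1, hwo y hy0 hy1]
    have hxy : π x ≠ π y := fun e => hyp (e.symm.trans hxp)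
    by_cases hx1 : x = x₁
    · subst hx1
      rw [hw1, mul_one, ← hKy y hyp.symm]
      congr 1
      ext d
      simp [h'1]
    by_cases hx0 : x = x₀
    · subst hx0
      have h2 : (Finset.univ.filter fun d => h' d = x ∧ h (rev d) = y)
          = (Finset.univ.filter fun d => h d = x ∧ h (rev d) = y) \
            (K.filter fun d => h (rev d) = y) := by
        ext d
        simp only [Finset.mem_filter, Finset.mem_univ, true_and, Finset.mem_sdiff, h'0]
        tauto
      rw [h2, Finset.card_sdiff_of_subset, H.mult x y hxy, hKy y hyp.symm, hw0]
      · obtain ⟨g, hg⟩ : ∃ g, w x = g + 1 := ⟨w x - 1, by omega⟩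
        rw [hg, Nat.add_sub_cancel, Nat.mul_succ, Nat.add_mul, Nat.add_sub_cancel]
      · intro d hd
        rw [Finset.mem_filter] at hd
        simp [hK d hd.1, hd.2]
    · simp only [h'o x hx0 hx1, hwo x hx0 hx1]
      exact H.mult x y hxy
  refine ⟨h', hπ', ⟨fun d => by rw [hπ', hπ']; exact H.ne d, ?_, ?_, ?_⟩⟩
  · intro x y hxy
    by_cases hxp : π x = π x₀
    · exact hmult0 x y hxp fun e => hxy (hxp.trans e.symm)
    · by_cases hyp : π y = π x₀
      · rw [mul_right_comm, ← hmult0 y x hyp hxp]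
        refine Finset.card_bij' (fun d _ => rev d) (fun d _ => rev d) ?_ ?_ ?_ ?_
        · intro d hd
          simp only [Finset.mem_filter, Finset.mem_univ, true_and, hrev d] at hd ⊢
          exact hd.symm
        · intro d hd
          simp only [Finset.mem_filter, Finset.mem_univ, true_and, hrev d] at hd ⊢
          exact hd.symm
        · intro d _; exact hrev d
        · intro d _; exact hrev d
      · have e1 : ∀ z, π z ≠ π x₀ → z ≠ x₀ := fun z e e' => e (congrArg π e')
        have e2 : ∀ z, π z ≠ π x₀ → z ≠ x₁ := fun z e e' => e ((congrArg π e').trans hπ)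
        simp only [h'o x (e1 x hxp) (e2 x hxp), h'o y (e1 y hyp) (e2 y hyp),
          hwo x (e1 x hxp) (e2 x hxp), hwo y (e1 y hyp) (e2 y hyp)]
        exact H.mult x y hxy
  · intro j x
    by_cases hx1 : x = x₁
    · subst hx1
      rw [hw1, mul_one, hπ, ← hKj j]
      congr 1
      ext d
      simp [h'1, and_comm]
    by_cases hx0 : x = x₀
    · subst hx0
      have h2 : (Finset.univ.filter fun d => c d = j ∧ h' d = x)
          = (Finset.univ.filter fun d => c d = j ∧ h d = x) \ (K.filter fun d => c d = j) := by
        ext d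
        simp only [Finset.mem_filter, Finset.mem_univ, true_and, Finset.mem_sdiff, h'0]
        tauto
      rw [h2, Finset.card_sdiff_of_subset, H.degree, hKj, hw0]
      · obtain ⟨g, hg⟩ : ∃ g, w x = g + 1 := ⟨w x - 1, by omega⟩
        rw [hg, Nat.add_sub_cancel, Nat.mul_succ, Nat.add_sub_cancel]
      · intro d hd
        rw [Finset.mem_filter] at hd
        simp [hK d hd.1, hd.2]
    · simp only [h'o x hx0 hx1, hwo x hx0 hx1]
      exact H.degree j x
  · intro j hjZ P hP
    have hPe : ∀ x y, Relation.EqvGen (adjAvoiding rev c h x₀ j) x y → (P x ↔ P y) := by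
      intro x y e
      induction e with
      | rel x y e =>
        obtain ⟨d, hd, rfl, rfl, e0, e1⟩ := e
        have h2 := hP d hd
        rwa [hout d fun hm => e0 (hK d hm), hout _ fun hm => e1 (hK _ hm)] at h2
      | refl => exact Iff.rfl
      | symm _ _ _ ih => exact ih.symm
      | trans _ _ _ _ _ ih1 ih2 => exact ih1.trans ih2
    -- The component reached by a moved dart still has an unmoved dart to `x₀`, so an invariant of
    -- the new graph is also an invariant of the old one.
    have hPK : ∀ d ∈ K, c d = j → (P x₀ ↔ P (h (rev d))) := by
      intro d hd hdj
      obtain ⟨d', hd', hdK, hdc, e⟩ := hKZ d (hK d hd) (hdj ▸ hjZ)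
      have h2 := hP d' (hdc.trans hdj)
      have h3 : rev d' ∉ K := fun hm => hloop d' (hd'.trans (hK _ hm).symm)
      rw [hout d' hdK, hout _ h3, hd'] at h2
      exact h2.trans (hPe _ _ (hdj ▸ e))
    have hPold : ∀ d, c d = j → (P (h d) ↔ P (h (rev d))) := by
      intro d hdj
      by_cases hd : d ∈ K
      · rw [hK d hd]; exact hPK d hd hdj
      by_cases hd' : rev d ∈ K
      · rw [hK _ hd']
        have h2 := hPK _ hd' ((hc d).trans hdj)
        rw [hrev d] at h2
        exact h2.symm
      · have h2 := hP d hdj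
        rwa [hout d hd, hout _ hd'] at h2
    have hconn := H.connected j hjZ P hPold
    -- A nonzero colour degree supplies a moved dart, which ties `x₁` to a component that is still
    -- attached to `x₀`.
    have hP1 : δ j (π x₀) ≠ 0 → (P x₁ ↔ P x₀) := by
      intro hδ
      obtain ⟨d, hd⟩ : (K.filter fun d => c d = j).Nonempty := by
        rw [← Finset.card_pos, hKj]; omega
      rw [Finset.mem_filter] at hd
      have h2 := hP d hd.2
      rw [hin d hd.1, hout _ (hKr d hd.1)] at h2
      exact h2.trans (hPK d hd.1 hd.2).symm
    have key : ∀ x, δ j (π x) ≠ 0 → w' x ≠ 0 →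
        ∃ x', δ j (π x') ≠ 0 ∧ w x' ≠ 0 ∧ (P x ↔ P x') := by
      intro x hδ hwx
      by_cases hx1 : x = x₁
      · subst hx1
        rw [hπ] at hδ
        exact ⟨x₀, hδ, by omega, hP1 hδ⟩
      by_cases hx0 : x = x₀
      · subst hx0
        exact ⟨x, hδ, by omega, Iff.rfl⟩
      · exact ⟨x, hδ, by rwa [hwo x hx0 hx1] at hwx, Iff.rfl⟩
    intro x y hδx hδy hwx hwy
    obtain ⟨x', e1, e2, e3⟩ := key x hδx hwx
    obtain ⟨y', f1, f2, f3⟩ := key y hδy hwy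
    exact e3.trans ((hconn x' y' e1 f1 e2 f2).trans f3.symm)

/-- An amalgamation whose parts have total weight equal to their size can be fully detached. -/
theorem IsAmalgamation.exists_detachment (H : IsAmalgamation π rev c lam δ Z w h)
    (hrev : rev.Involutive) (hc : ∀ d, c (rev d) = c d) (hZ : ∀ j ∈ Z, ∀ v, Even (δ j v))
    (hw : ∀ v, ∑ x ∈ Finset.univ.filter (fun x => π x = v), w x
      = (Finset.univ.filter fun x => π x = v).card) :
    ∃ h' : D → X, (∀ d, π (h' d) = π (h d)) ∧
      IsAmalgamation π rev c lam δ Z (fun _ => 1) h' := by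
  classical
  induction hN : (Finset.univ.filter fun x => w x = 0).card generalizing w h with
  | zero =>
    rw [Finset.card_eq_zero, Finset.filter_eq_empty_iff] at hN
    have h1 : ∀ x, w x = 1 := by
      intro x
      have h2 : ∑ x' ∈ Finset.univ.filter (fun x' => π x' = π x), 1
          = ∑ x' ∈ Finset.univ.filter (fun x' => π x' = π x), w x' := by
        rw [hw, Finset.card_eq_sum_ones]
      exact ((Finset.sum_eq_sum_iff_of_le fun x' _ =>
        Nat.one_le_iff_ne_zero.2 (hN (Finset.mem_univ x'))).1 h2 x (by simp)).symm
    exact ⟨h, fun _ => rfl, by rwa [show w = fun _ => 1 from funext h1] at H⟩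
  | succ N ih =>
    obtain ⟨x₁, hx₁⟩ : (Finset.univ.filter fun x => w x = 0).Nonempty := by
      rw [← Finset.card_pos]; omega
    have hw1 : w x₁ = 0 := by simpa using hx₁
    -- Pigeonhole: the average weight in a part is 1, so a vertex of weight 0 forces one of weight
    -- at least 2.
    obtain ⟨x₀, hx₀, hw0⟩ : ∃ x₀, π x₀ = π x₁ ∧ 2 ≤ w x₀ := by
      by_contra hcon
      push Not at hcon
      have h2 : ∑ x' ∈ Finset.univ.filter (fun x' => π x' = π x₁), w x'
          < ∑ x' ∈ Finset.univ.filter (fun x' => π x' = π x₁), 1 := by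
        refine Finset.sum_lt_sum (fun x hx => ?_) ⟨x₁, by simp, by omega⟩
        have := hcon x (by simpa using hx)
        omega
      rw [hw, ← Finset.card_eq_sum_ones] at h2
      exact lt_irrefl _ h2
    have hx : x₀ ≠ x₁ := by rintro rfl; omega
    obtain ⟨h', hπ', H'⟩ := H.exists_split hrev hc hZ hw0 hw1 hx₀.symm
    obtain ⟨h'', hπ'', H''⟩ := ih H' (by
      intro v
      rw [← hw v]
      by_cases hv : π x₀ = v
      · have m0 : x₀ ∈ Finset.univ.filter (fun x => π x = v) := by simp [hv]
        have m1 : x₁ ∈ (Finset.univ.filter (fun x => π x = v)).erase x₀ := by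
          simp [hx.symm, ← hx₀, hv]
        rw [← Finset.add_sum_erase _ _ m0, ← Finset.add_sum_erase _ _ m1,
          ← Finset.add_sum_erase _ w m0, ← Finset.add_sum_erase _ w m1,
          Function.update_self, Function.update_of_ne hx, Function.update_self]
        rw [Finset.sum_congr rfl (g := fun x => w x)]
        · omega
        · intro x hx'
          simp only [Finset.mem_erase] at hx'
          rw [Function.update_of_ne hx'.1, Function.update_of_ne hx'.2.1]
      · refine Finset.sum_congr rfl fun x hx' => ?_
        have e : π x = v := by simpa using hx'
        rw [Function.update_of_ne, Function.update_of_ne]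
        · rintro rfl; exact hv e
        · rintro rfl; exact hv (hx₀.trans e)) (by
      have : (Finset.univ.filter fun x =>
          Function.update (Function.update w x₀ (w x₀ - 1)) x₁ 1 x = 0)
          = (Finset.univ.filter fun x => w x = 0).erase x₁ := by
        ext x
        simp only [Finset.mem_filter, Finset.mem_univ, true_and, Finset.mem_erase]
        by_cases e1 : x = x₁
        · subst e1; simp
        by_cases e0 : x = x₀
        · subst e0
          rw [Function.update_of_ne e1, Function.update_self]
          omega
        · rw [Function.update_of_ne e1, Function.update_of_ne e0]
          simp [e1]
      rw [this, Finset.card_erase_of_mem hx₁, hN, Nat.add_sub_cancel])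
    exact ⟨h'', fun d => (hπ'' d).trans (hπ' d), H''⟩

end Detachment

/-! ### Tracing cycles and labelling parallel edges -/

/-- In a finite loopless multigraph given by darts with exactly two darts `C` at every vertex that
has one, every dart lies on a cycle, and this cycle contains all darts at its vertices. -/
theorem exists_cyclic_darts {X D : Type*} [Finite X] {rev : D → D} {h : D → X} {C : D → Prop}
    (hrev : rev.Involutive) (hC : ∀ d, C d → C (rev d)) (hloop : ∀ d, h d ≠ h (rev d))
    (hex : ∀ d, C d → ∃ d', C d' ∧ h d' = h d ∧ d' ≠ d)
    (huniq : ∀ d₁ d₂ d₃, C d₁ → C d₂ → C d₃ → h d₁ = h d₂ → h d₁ = h d₃ →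
      d₁ = d₂ ∨ d₁ = d₃ ∨ d₂ = d₃)
    {d₀ : D} (hd₀ : C d₀) :
    ∃ (c : ℕ) (f : ZMod c → D), 2 ≤ c ∧ (∀ i, C (f i)) ∧ Function.Injective (fun i => h (f i)) ∧
      (∀ i, h (rev (f i)) = h (f (i + 1))) ∧ (∀ i, f (i + 1) ≠ rev (f i)) ∧ f 0 = d₀ ∧
      ∀ d, C d → ∀ i, h d = h (f i) → ∃ i', d = f i' ∨ d = rev (f i') := by
  classical
  choose! nx hnx1 hnx2 hnx3 using hex
  -- The walk that traverses a dart and then leaves the vertex reached by its other dart, never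
  -- turning straight back.
  let s : ℕ → D := fun k => (fun d => nx (rev d))^[k] d₀
  have hs0 : s 0 = d₀ := rfl
  have hss : ∀ k, s (k + 1) = nx (rev (s k)) := fun k => Function.iterate_succ_apply' _ k d₀
  have hsC : ∀ k, C (s k) := by
    intro k
    induction k with
    | zero => exact hd₀
    | succ k ih => rw [hss]; exact hnx1 _ (hC _ ih)
  have hsh : ∀ k, h (s (k + 1)) = h (rev (s k)) := fun k => by rw [hss]; exact hnx2 _ (hC _ (hsC k))
  have hsne : ∀ k, s (k + 1) ≠ rev (s k) := fun k => by rw [hss]; exact hnx3 _ (hC _ (hsC k))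
  have hrep : ∃ c, ∃ a, a < c ∧ h (s a) = h (s c) := by
    obtain ⟨a, b, hab, e⟩ := Finite.exists_ne_map_eq_of_infinite fun k => h (s k)
    rcases lt_or_gt_of_ne hab with hl | hl
    · exact ⟨b, a, hl, e⟩
    · exact ⟨a, b, hl, e.symm⟩
  obtain ⟨c, ⟨a, hac, hvac⟩, hmin⟩ : ∃ c, (∃ a, a < c ∧ h (s a) = h (s c)) ∧
      ∀ c' < c, ¬ ∃ a, a < c' ∧ h (s a) = h (s c') :=
    ⟨Nat.find hrep, Nat.find_spec hrep, fun c' hc' => Nat.find_min hrep hc'⟩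
  have hinj : ∀ i j, i < c → j < c → h (s i) = h (s j) → i = j := by
    intro i j hi hj e
    rcases lt_trichotomy i j with hl | hl | hl
    · exact absurd ⟨i, hl, e⟩ (hmin j hj)
    · exact hl
    · exact absurd ⟨j, hl, e.symm⟩ (hmin i hi)
  obtain ⟨p, rfl⟩ : ∃ p, c = p + 1 := ⟨c - 1, by omega⟩
  rw [hsh] at hvac
  -- A first return to a later vertex would put three darts there: the outgoing one, the reverse of
  -- the one first used to enter, and the reverse of the returning one. Two must coincide, and each
  -- coincidence contradicts minimality, looplessness or the absence of backtracking.
  have ha0 : a = 0 := by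
    by_contra ha
    obtain ⟨b, rfl⟩ : ∃ b, a = b + 1 := ⟨a - 1, by omega⟩
    rcases huniq (rev (s p)) (s (b + 1)) (rev (s b)) (hC _ (hsC p)) (hsC _) (hC _ (hsC b))
      hvac.symm (by rw [← hvac, hsh]) with e | e | e
    · have h1 : h (s p) = h (s (b + 1 + 1)) := by rw [hsh, ← e, hrev]
      by_cases hb : b + 1 + 1 < p + 1
      · have h2 := hinj p (b + 1 + 1) (by omega) hb h1
        subst h2
        exact hsne (b + 1) (by rw [← e, hrev])
      · have h2 : p = b + 1 := by omega
        subst h2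
        exact hloop (s (b + 1)) (by rw [e])
    · have h2 := hinj p b (by omega) (by omega) (by rw [hrev.injective e])
      omega
    · exact hsne b e
  subst ha0
  have hp : 1 ≤ p := by
    by_contra hp
    obtain rfl : p = 0 := by omega
    exact hloop _ hvac
  -- The closing edge is not the first edge traversed backwards; this matters for 2-cycles, which
  -- need two distinct parallel edges.
  have hclose : s 0 ≠ rev (s p) := by
    intro e
    have h1 : h (s p) = h (s 1) := by rw [hsh, e, hrev]
    have h2 := hinj p 1 (by omega) (by omega) h1
    subst h2
    exact hsne 0 (by rw [e, hrev])
  have : NeZero (p + 1) := ⟨by omega⟩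
  have hval : ∀ i : ZMod (p + 1), i.val < p + 1 := fun i => ZMod.val_lt i
  have hsucc : ∀ i : ZMod (p + 1), (i.val < p ∧ (i + 1).val = i.val + 1) ∨
      (i.val = p ∧ (i + 1).val = 0) := by
    intro i
    have h1 : (i + 1).val = (i.val + 1) % (p + 1) := by
      rw [ZMod.val_add, ZMod.val_one'' (by omega)]
    rcases Nat.lt_or_ge i.val p with hl | hl
    · exact .inl ⟨hl, by rw [h1, Nat.mod_eq_of_lt (by omega)]⟩
    · have h2 : i.val = p := by have := hval i; omega
      exact .inr ⟨h2, by rw [h1, h2, Nat.mod_self]⟩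
  refine ⟨p + 1, fun i => s i.val, by omega, fun i => hsC _, ?_, ?_, ?_, ?_, ?_⟩
  · intro i j e
    exact ZMod.val_injective _ (hinj _ _ (hval i) (hval j) e)
  · intro i
    rcases hsucc i with ⟨-, e⟩ | ⟨e, e'⟩
    · simp only [e, hsh]
    · simp only [e', e]; exact hvac.symm
  · intro i
    rcases hsucc i with ⟨-, e⟩ | ⟨e, e'⟩
    · simp only [e]; exact hsne _
    · simp only [e', e]; exact hclose
  · simp only [ZMod.val_zero, hs0]
  · intro d hd i hi
    have hcast : ∀ k, k < p + 1 → ((k : ZMod (p + 1))).val = k := fun k hk =>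
      ZMod.val_cast_of_lt hk
    rcases Nat.eq_zero_or_pos i.val with e | e
    · simp only [e] at hi
      rcases huniq d (s 0) (rev (s p)) hd (hsC _) (hC _ (hsC p)) hi (hi.trans hvac) with e | e | e
      · exact ⟨0, .inl (by simpa using e)⟩
      · exact ⟨(p : ℕ), .inr (by simp only [hcast p (by omega)]; exact e)⟩
      · exact absurd e hclose
    · obtain ⟨b, hb⟩ : ∃ b, i.val = b + 1 := ⟨i.val - 1, by omega⟩
      have := hval i
      simp only [hb] at hi
      rcases huniq d (s (b + 1)) (rev (s b)) hd (hsC _) (hC _ (hsC b)) hi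
        (hi.trans (hsh b)) with e | e | e
      · exact ⟨i, .inl (by simp only [hb]; exact e)⟩
      · exact ⟨(b : ℕ), .inr (by simp only [hcast b (by omega)]; exact e)⟩
      · exact absurd e (hsne b)

/-- If between vertices of distinct parts there are exactly `lam` darts in each direction, then
parallel edges can be distinguished by labels in `Fin lam`. -/
theorem exists_dart_labels {X V D : Type*} [Fintype D] [LinearOrder V] [DecidableEq X]
    {π : X → V} {rev : D → D} {h : D → X} (hrev : rev.Involutive)
    (hne : ∀ d, π (h d) ≠ π (h (rev d))) {lam : ℕ} (hlam : 0 < lam)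
    (hmult : ∀ x y, π x ≠ π y →
      (Finset.univ.filter fun d => h d = x ∧ h (rev d) = y).card = lam) :
    ∃ t : D → Fin lam, (∀ d, t (rev d) = t d) ∧
      (∀ d d', s(h d, h (rev d)) = s(h d', h (rev d')) → t d = t d' → d' = d ∨ d' = rev d) ∧
      ∀ x y, π x ≠ π y → ∀ i, ∃ d, h d = x ∧ h (rev d) = y ∧ t d = i := by
  classical
  have hτ : ∀ x y, ∃ τ : D → Fin lam, π x ≠ π y →
      (∀ d d', h d = x → h (rev d) = y → h d' = x → h (rev d') = y → τ d = τ d' → d = d') ∧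
      ∀ i, ∃ d, h d = x ∧ h (rev d) = y ∧ τ d = i := by
    intro x y
    by_cases hxy : π x = π y
    · exact ⟨fun _ => ⟨0, hlam⟩, fun hn => absurd hxy hn⟩
    let e := Finset.equivFinOfCardEq (hmult x y hxy)
    refine ⟨fun d => if hd : d ∈ Finset.univ.filter (fun d => h d = x ∧ h (rev d) = y) then
      e ⟨d, hd⟩ else ⟨0, hlam⟩, fun _ => ⟨?_, ?_⟩⟩
    · intro d d' h1 h2 h3 h4 h5
      beta_reduce at h5
      rw [dif_pos (by simp [h1, h2]), dif_pos (by simp [h3, h4])] at h5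
      simpa using h5
    · intro i
      have h1 := (e.symm i).2
      have h2 := (Finset.mem_filter.1 h1).2
      exact ⟨(e.symm i).1, h2.1, h2.2, by simp only [dif_pos h1]; exact e.apply_symm_apply i⟩
  choose τ hτ using hτ
  -- Both darts of an edge must receive the same label, so the label is read off the dart going from
  -- the smaller part to the larger one.
  let o : D → D := fun d => if π (h d) < π (h (rev d)) then d else rev d
  have horev : ∀ d, o (rev d) = o d := by
    intro d
    simp only [o, hrev d]
    rcases lt_or_gt_of_ne (hne d) with hl | hl
    · rw [if_neg hl.not_gt, if_pos hl]
    · rw [if_pos hl, if_neg hl.not_gt]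
  have ho : ∀ d, o d = d ∨ o d = rev d := by
    intro d
    simp only [o]
    split_ifs <;> simp
  have holt : ∀ d, π (h (o d)) < π (h (rev (o d))) := by
    intro d
    simp only [o]
    split_ifs with hl
    · exact hl
    · rw [hrev d]; exact lt_of_le_of_ne (not_lt.1 hl) (hne d).symm
  have hos : ∀ d, s(h (o d), h (rev (o d))) = s(h d, h (rev d)) := by
    intro d
    rcases ho d with e | e
    · rw [e]
    · rw [e, hrev d, Sym2.eq_swap]
  refine ⟨fun d => τ (h (o d)) (h (rev (o d))) (o d), fun d => by simp only [horev], ?_, ?_⟩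
  · intro d d' hs ht
    beta_reduce at ht
    rw [← hos d, ← hos d', Sym2.eq_iff] at hs
    rcases hs with ⟨e1, e2⟩ | ⟨e1, e2⟩
    · have h1 : o d = o d' := (hτ _ _ (holt d).ne).1 _ _ rfl rfl e1.symm e2.symm (by
        rw [ht, e1, e2])
      rcases ho d with e | e <;> rcases ho d' with e' | e' <;> rw [e, e'] at h1
      · exact .inl h1.symm
      · exact .inr (by rw [h1, hrev])
      · exact .inr h1.symm
      · exact .inl (hrev.injective h1).symm
    · have h1 := holt d
      rw [e1, e2] at h1
      exact absurd h1 (holt d').not_gt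
  · intro x y hxy i
    rcases lt_or_gt_of_ne hxy with hl | hl
    · obtain ⟨d, rfl, rfl, h3⟩ := (hτ x y hxy).2 i
      have : o d = d := if_pos hl
      exact ⟨d, rfl, rfl, by simp only [this, h3]⟩
    · obtain ⟨d, rfl, rfl, h3⟩ := (hτ y x hxy.symm).2 i
      have : o (rev d) = d := by rw [horev]; exact if_pos hl
      exact ⟨rev d, rfl, by rw [hrev], by simp only [this, h3]⟩

/-! ### Degrees, cycles and unions of cycles -/

section Graphs

variable {α β ι κ : Type*} {G H : Graph α β}

theorem not_isLink_fold_self {W : Type*} (μ : ℕ) (S : SimpleGraph W) (e : Sym2 W × Fin μ) (x : W) :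
    ¬ (fold μ S).IsLink e x x := fun h => S.loopless.irrefl x h.1

theorem not_isLink_completeMulti_self (μ n : ℕ) (e : Sym2 (Fin n) × Fin μ) (x : Fin n) :
    ¬ (completeMulti μ n).IsLink e x x := not_isLink_fold_self _ _ e x

theorem not_isLink_equipartite_self (lam n m : ℕ) (e : Sym2 (Fin n × Fin m) × Fin lam)
    (x : Fin n × Fin m) : ¬ (equipartite lam n m).IsLink e x x := not_isLink_fold_self _ _ e x

theorem deg_eq_ncard_incidenceSet (hG : ∀ e x, ¬ G.IsLink e x x) (x : α) :
    deg G x = (G.incidenceSet x).ncard := by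
  have : G.loopSet x = ∅ := Set.eq_empty_of_forall_notMem fun e he => hG e x he
  rw [deg, this, Set.ncard_empty, add_zero]

theorem deg_eq_zero_of_notMem {x : α} (hx : x ∉ V(G)) : deg G x = 0 := by
  have h1 : G.incidenceSet x = ∅ :=
    Set.eq_empty_of_forall_notMem fun e he => hx (Graph.Inc.vertex_mem he)
  have h2 : G.loopSet x = ∅ :=
    Set.eq_empty_of_forall_notMem fun e he => hx (Graph.IsLoopAt.vertex_mem he)
  rw [deg, h1, h2, Set.ncard_empty]

/-- Degrees add up over edge-disjoint graphs. -/
theorem deg_eq_sum_of_incidenceSet_eq [Finite β] {H : ι → Graph α β} (x : α) (P : Finset ι)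
    (hG : ∀ e x, ¬ G.IsLink e x x) (hH : ∀ i e x, ¬ (H i).IsLink e x x)
    (hdisj : Pairwise fun i j => Disjoint E(H i) E(H j))
    (hinc : ∀ e, G.Inc e x ↔ ∃ i ∈ P, (H i).Inc e x) :
    deg G x = ∑ i ∈ P, deg (H i) x := by
  have h1 : G.incidenceSet x = ⋃ i ∈ (P : Set ι), (H i).incidenceSet x := by
    ext e
    simpa using hinc e
  rw [deg_eq_ncard_incidenceSet hG, h1,
    P.finite_toSet.ncard_biUnion (fun _ _ => Set.toFinite _), finsum_mem_coe_finset]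
  · exact Finset.sum_congr rfl fun i _ => (deg_eq_ncard_incidenceSet (hH i) x).symm
  · intro i _ j _ hij
    exact (hdisj hij).mono ((H i).incidenceSet_subset_edgeSet x) ((H j).incidenceSet_subset_edgeSet x)

theorem IsDecomposition.deg_eq_sum [Finite β] [Fintype ι] {H : ι → Graph α β}
    (hD : IsDecomposition G H) (hG : ∀ e x, ¬ G.IsLink e x x) (x : α) :
    deg G x = ∑ i, deg (H i) x := by
  refine deg_eq_sum_of_incidenceSet_eq x Finset.univ hG
    (fun i e x h => hG e x (h.mono (hD.1 i))) hD.2.1 fun e => ⟨fun h => ?_, ?_⟩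
  · have h1 := h.edge_mem
    rw [hD.2.2, Set.mem_iUnion] at h1
    obtain ⟨i, hi⟩ := h1
    exact ⟨i, Finset.mem_univ i, ((hD.1 i).inc_congr hi).2 h⟩
  · rintro ⟨i, -, h⟩
    exact h.mono (hD.1 i)

theorem IsCycleOfLength.ncard_vertexSet {c : ℕ} (h : IsCycleOfLength c H) : V(H).ncard = c := by
  obtain ⟨hc, v, e, hv, -, hV, -⟩ := h
  rw [hV, ← Set.image_univ, Set.ncard_image_of_injective _ hv, Set.ncard_univ, Nat.card_zmod]

theorem IsCycle.isCycleOfLength (h : IsCycle H) : IsCycleOfLength V(H).ncard H := by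
  obtain ⟨c, hc⟩ := h
  rwa [hc.ncard_vertexSet]

theorem IsCycle.vertexSet_nonempty (h : IsCycle H) : V(H).Nonempty := by
  obtain ⟨c, hc, v, e, -, -, hV, -⟩ := h
  exact hV ▸ ⟨v 0, 0, rfl⟩

theorem IsCycle.deg_eq_two (h : IsCycle H) {x : α} (hx : x ∈ V(H)) : deg H x = 2 := by
  obtain ⟨c, hc, v, e, hv, he, hV, hE, hl⟩ := h
  have : Fact (1 < c) := ⟨hc⟩
  have hloop : ∀ f y, ¬ H.IsLink f y y := by
    intro f y hf
    obtain ⟨j, rfl⟩ : f ∈ Set.range e := hE ▸ hf.edge_mem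
    have h1 : v j = v (j + 1) := by
      rcases hf.eq_and_eq_or_eq_and_eq (hl j) with ⟨h1, h2⟩ | ⟨h1, h2⟩
      · exact h1.symm.trans h2
      · exact h2.symm.trans h1
    exact one_ne_zero (left_eq_add.1 (hv h1))
  obtain ⟨i, rfl⟩ : x ∈ Set.range v := hV ▸ hx
  have h1 : H.incidenceSet (v i) = {e i, e (i - 1)} := by
    ext f
    simp only [Graph.mem_incidenceSet, Set.mem_insert_iff, Set.mem_singleton_iff]
    constructor
    · intro hf
      obtain ⟨j, rfl⟩ : f ∈ Set.range e := hE ▸ hf.edge_mem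
      rcases hf.eq_or_eq_of_isLink (hl j) with h2 | h2
      · exact .inl (by rw [hv h2])
      · exact .inr (by rw [hv h2, add_sub_cancel_right])
    · rintro (rfl | rfl)
      · exact (hl i).inc_left
      · have h2 := (hl (i - 1)).inc_right
        rwa [sub_add_cancel] at h2
  rw [deg_eq_ncard_incidenceSet hloop, h1, Set.ncard_pair]
  intro h2
  have h3 : i - 1 = i - 0 := by rw [sub_zero]; exact (he h2).symm
  exact one_ne_zero (sub_right_injective h3)

/-- Cycles are connected. -/
theorem IsCycle.iff_of_forall_isLink (h : IsCycle H) {P : α → Prop}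
    (hP : ∀ e x y, H.IsLink e x y → (P x ↔ P y)) {x y : α} (hx : x ∈ V(H)) (hy : y ∈ V(H)) :
    P x ↔ P y := by
  obtain ⟨c, hc, v, e, hv, he, hV, hE, hl⟩ := h
  have : NeZero c := ⟨by omega⟩
  have key : ∀ k : ℕ, P (v k) ↔ P (v 0) := by
    intro k
    induction k with
    | zero => simp
    | succ k ih =>
      rw [← ih, Nat.cast_succ]
      exact (hP _ _ _ (hl k)).symm
  have key' : ∀ z ∈ V(H), P z ↔ P (v 0) := by
    intro z hz
    obtain ⟨i, rfl⟩ : z ∈ Set.range v := hV ▸ hz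
    rw [← key i.val, ZMod.natCast_zmod_val]
  exact (key' x hx).trans (key' y hy).symm

theorem mem_vertexSet_unionIn {C : ι → Graph α β} {P : Set ι} {x : α} :
    x ∈ V(unionIn G C P) ↔ ∃ i ∈ P, x ∈ V(C i) := by
  simp [unionIn]

theorem unionIn_isLink {C : ι → Graph α β} {P : Set ι} (hC : ∀ i, C i ≤ G) {e : β} {x y : α} :
    (unionIn G C P).IsLink e x y ↔ ∃ i ∈ P, (C i).IsLink e x y :=
  ⟨fun h => h.2, fun ⟨i, hi, h⟩ => ⟨h.mono (hC i), i, hi, h⟩⟩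

theorem le_unionIn {C : ι → Graph α β} {P : Set ι} (hC : ∀ i, C i ≤ G) {i : ι} (hi : i ∈ P) :
    C i ≤ unionIn G C P :=
  ⟨fun _ hx => mem_vertexSet_unionIn.2 ⟨i, hi, hx⟩,
    fun _ _ _ h => (unionIn_isLink hC).2 ⟨i, hi, h⟩⟩

theorem unionIn_le {C : ι → Graph α β} {P : Set ι} (hC : ∀ i, C i ≤ G) : unionIn G C P ≤ G :=
  ⟨fun _ hx => by
    obtain ⟨i, -, hi⟩ := mem_vertexSet_unionIn.1 hx
    exact (hC i).vertexSet_mono hi, fun _ _ _ h => h.1⟩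

theorem edgeSet_unionIn {C : ι → Graph α β} {P : Set ι} (hC : ∀ i, C i ≤ G) :
    E(unionIn G C P) = ⋃ i ∈ P, E(C i) := by
  ext e
  simp only [Graph.edge_mem_iff_exists_isLink, unionIn_isLink hC, Set.mem_iUnion]
  constructor
  · rintro ⟨x, y, i, hi, h⟩
    exact ⟨i, hi, x, y, h⟩
  · rintro ⟨i, hi, x, y, h⟩
    exact ⟨x, y, i, hi, h⟩

/-- Edge-disjointness lets degrees add, and a cycle contributes 2 at its own vertices and 0
elsewhere. Degrees thus depend only on which cycles pass through a vertex, the incidence data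
controlled by detachment. -/
theorem deg_unionIn [Finite β] [Fintype ι] {C : ι → Graph α β} (P : Set ι)
    (hG : ∀ e x, ¬ G.IsLink e x x) (hC : ∀ i, C i ≤ G)
    (hdisj : Pairwise fun i j => Disjoint E(C i) E(C j)) (hcyc : ∀ i, IsCycle (C i)) (x : α) :
    deg (unionIn G C P) x = 2 * {i | i ∈ P ∧ x ∈ V(C i)}.ncard := by
  classical
  rw [deg_eq_sum_of_incidenceSet_eq (G := unionIn G C P) (H := C) x (Finset.univ.filter (· ∈ P))
    (fun e x h => hG e x h.1) (fun i e x h => hG e x (h.mono (hC i))) hdisj]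
  · have h1 : ∀ i, deg (C i) x = if x ∈ V(C i) then 2 else 0 := by
      intro i
      split_ifs with h
      · exact (hcyc i).deg_eq_two h
      · exact deg_eq_zero_of_notMem h
    simp only [h1]
    rw [← Finset.sum_filter, Finset.filter_filter, Finset.sum_const, smul_eq_mul, mul_comm,
      Set.ncard_eq_toFinset_card']
    congr 2
    ext i
    simp
  · intro e
    simp only [Graph.Inc, unionIn_isLink hC, Finset.mem_filter, Finset.mem_univ, true_and]
    constructor
    · rintro ⟨y, i, hi, h⟩
      exact ⟨i, hi, y, h⟩
    · rintro ⟨i, hi, y, h⟩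
      exact ⟨y, i, hi, h⟩

theorem IsDecomposition.unionIn_fibers {C : ι → Graph α β} (hD : IsDecomposition G C)
    (p : ι → κ) : IsDecomposition G fun s => unionIn G C {i | p i = s} := by
  refine ⟨fun s => unionIn_le hD.1, fun s s' hs => ?_, ?_⟩
  · beta_reduce
    rw [edgeSet_unionIn hD.1, edgeSet_unionIn hD.1]
    simp only [Set.disjoint_iUnion_left, Set.disjoint_iUnion_right]
    rintro i rfl j rfl
    exact hD.2.1 fun h => hs (by rw [h])
  · rw [hD.2.2]
    ext e
    simp [edgeSet_unionIn hD.1]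

theorem isDecomposition_option_iff {I : Graph α β} {C : ι → Graph α β} :
    IsDecomposition G (fun o : Option ι => o.elim I C) ↔
      I ≤ G ∧ (∀ i, C i ≤ G) ∧ (∀ i, Disjoint E(I) E(C i)) ∧
        (Pairwise fun i j => Disjoint E(C i) E(C j)) ∧ E(G) = E(I) ∪ ⋃ i, E(C i) := by
  constructor
  · rintro ⟨h1, h2, h3⟩
    refine ⟨h1 none, fun i => h1 (some i), fun i => @h2 none (some i) (by simp),
      fun i j hij => @h2 (some i) (some j) (by simpa using hij), ?_⟩
    rw [h3, Set.iUnion_option]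
    rfl
  · rintro ⟨h1, h2, h3, h4, h5⟩
    refine ⟨?_, ?_, ?_⟩
    · rintro (_ | i)
      · exact h1
      · exact h2 i
    · rintro (_ | i) (_ | j) hij
      · exact absurd rfl hij
      · exact h3 j
      · exact (h3 i).symm
      · exact h4 fun e => hij (by rw [e])
    · rw [h5, Set.iUnion_option]
      rfl

theorem IsDecompositionWithOneFactor.unionIn_fibers {C : ι → Graph α β}
    (hD : IsDecompositionWithOneFactor G C) (p : ι → κ) :
    IsDecompositionWithOneFactor G fun s => unionIn G C {i | p i = s} := by
  obtain ⟨I, hI, hD⟩ := hD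
  refine ⟨I, hI, ?_⟩
  obtain ⟨h1, h2, h3, h4, h5⟩ := isDecomposition_option_iff.1 hD
  refine isDecomposition_option_iff.2 ⟨h1, fun s => unionIn_le h2, fun s => ?_, fun s s' hs => ?_, ?_⟩
  · rw [edgeSet_unionIn h2]
    simp only [Set.disjoint_iUnion_right]
    exact fun i _ => h3 i
  · beta_reduce
    rw [edgeSet_unionIn h2, edgeSet_unionIn h2]
    simp only [Set.disjoint_iUnion_left, Set.disjoint_iUnion_right]
    rintro i rfl j rfl
    exact h4 fun h => hs (by rw [h])
  · rw [h5]
    congr 1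
    ext e
    simp [edgeSet_unionIn h2]

theorem IsCycleDecomposition.le_and_disjoint {C : ι → Graph α β}
    (hC : IsCycleDecomposition G C) :
    (∀ i, C i ≤ G) ∧ Pairwise fun i j => Disjoint E(C i) E(C j) := by
  rcases hC.2 with h | ⟨-, I, -, h⟩
  · exact ⟨h.1, h.2.1⟩
  · obtain ⟨-, h2, -, h4, -⟩ := isDecomposition_option_iff.1 h
    exact ⟨h2, h4⟩

theorem deg_fold {W : Type*} (μ : ℕ) (S : SimpleGraph W) (x : W) :
    deg (fold μ S) x = (S.neighborSet x).ncard * μ := by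
  rw [deg_eq_ncard_incidenceSet (not_isLink_fold_self μ S)]
  have h1 : (fold μ S).incidenceSet x
      = (fun p : W × Fin μ => (s(x, p.1), p.2)) '' (S.neighborSet x ×ˢ Set.univ) := by
    ext ⟨e, t⟩
    simp only [Graph.mem_incidenceSet, Set.mem_image, Set.mem_prod, Set.mem_univ, and_true]
    constructor
    · rintro ⟨y, h2, h3⟩
      exact ⟨(y, t), h2, by simpa using h3.symm⟩
    · rintro ⟨⟨y, t'⟩, h2, h3⟩
      rw [Prod.mk.injEq] at h3
      exact ⟨y, h2, h3.1.symm⟩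
  rw [h1, Set.ncard_image_of_injective, Set.ncard_prod, Set.ncard_univ, Nat.card_fin]
  rintro ⟨y, t⟩ ⟨y', t'⟩ h2
  simp only [Prod.mk.injEq, Sym2.congr_right] at h2
  rw [h2.1, h2.2]

theorem deg_completeMulti (μ n : ℕ) (x : Fin n) : deg (completeMulti μ n) x = (n - 1) * μ := by
  rw [completeMulti, deg_fold]
  congr 1
  have h1 : (⊤ : SimpleGraph (Fin n)).neighborSet x = {x}ᶜ := by
    ext y
    simp [eq_comm]
  rw [h1, Set.ncard_compl, Set.ncard_singleton, Nat.card_fin]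

/-- The value agrees with the degree in λmK_n, so odd degrees occur in both graphs simultaneously.
-/
theorem deg_equipartite (lam n m : ℕ) (x : Fin n × Fin m) :
    deg (equipartite lam n m) x = (n - 1) * (lam * m) := by
  rw [equipartite, deg_fold]
  have h1 : (SimpleGraph.completeEquipartiteGraph n m).neighborSet x = {x.1}ᶜ ×ˢ Set.univ := by
    ext y
    simp [eq_comm]
  rw [h1, Set.ncard_prod, Set.ncard_compl, Set.ncard_singleton, Nat.card_fin, Set.ncard_univ,
    Nat.card_fin]
  ring

end Graphs

/-! ### Properties inherited by every detached decomposition -/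

section Transfer

variable {ι : Type*} {lam n m : ℕ} {C : ι → Graph (Fin n) (Sym2 (Fin n) × Fin (lam * m))}
  {C' : ι → Graph (Fin n × Fin m) (Sym2 (Fin n × Fin m) × Fin lam)}

theorem IsDetached.mem_vertexSet_iff (h : IsDetached C C') (i : ι) (x : Fin n × Fin m) :
    x ∈ V(C' i) ↔ x.1 ∈ V(C i) := by
  rw [h.2 i]
  simp [part]

theorem IsDetached.ncard_vertexSet (h : IsDetached C C') (i : ι) :
    V(C' i).ncard = V(C i).ncard * m := by
  have : V(C' i) = V(C i) ×ˢ Set.univ := by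
    ext x
    simp [h.mem_vertexSet_iff]
  rw [this, Set.ncard_prod, Set.ncard_univ, Nat.card_fin]

/-- The length of a cycle is its number of vertices, and each vertex is replaced by a part of size
`m`. -/
theorem IsDetached.isCycleOfLength (h : IsDetached C C') {i : ι} {c : ℕ}
    (hc : IsCycleOfLength c (C i)) : IsCycleOfLength (c * m) (C' i) := by
  have := (h.1.1 i).isCycleOfLength
  rwa [h.ncard_vertexSet, hc.ncard_vertexSet] at this

/-- Detaching preserves regularity of unions of cycles. -/
theorem IsDetached.isFactor_unionIn [Fintype ι]
    (hC : IsCycleDecomposition (completeMulti (lam * m) n) C) (h : IsDetached C C')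
    {r : ℕ} {W : Set (Fin n)} {P : Set ι}
    (hF : IsFactor r ((completeMulti (lam * m) n).deleteVerts W)
      (unionIn (completeMulti (lam * m) n) C P)) :
    IsFactor r ((equipartite lam n m).deleteVerts {x | x.1 ∈ W})
      (unionIn (equipartite lam n m) C' P) := by
  obtain ⟨hle, hdisj⟩ := hC.le_and_disjoint
  obtain ⟨hle', hdisj'⟩ := h.1.le_and_disjoint
  have hVW : ∀ y, y ∈ V(unionIn (completeMulti (lam * m) n) C P) ↔ y ∉ W := by
    intro y
    rw [hF.1.vertexSet_eq, Graph.vertexSet_deleteVerts]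
    exact ⟨fun h => h.2, fun h => ⟨Set.mem_univ _, h⟩⟩
  have hV : ∀ x, x ∈ V(unionIn (equipartite lam n m) C' P) ↔
      x.1 ∈ V(unionIn (completeMulti (lam * m) n) C P) := by
    intro x
    simp only [mem_vertexSet_unionIn, h.mem_vertexSet_iff]
  have hVW' : ∀ x, x ∈ V(unionIn (equipartite lam n m) C' P) ↔ x.1 ∉ W :=
    fun x => (hV x).trans (hVW x.1)
  have hVe : V(unionIn (equipartite lam n m) C' P)
      = V((equipartite lam n m).deleteVerts {x | x.1 ∈ W}) := by
    ext x
    rw [hVW', Graph.vertexSet_deleteVerts]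
    exact ⟨fun h => ⟨Set.mem_univ _, h⟩, fun h => h.2⟩
  refine ⟨⟨⟨hVe.subset, fun e x y hl => ?_⟩, hVe⟩, fun x hx => ?_⟩
  · exact (Graph.deleteVerts_isLink _ _).2
      ⟨hl.1, (hVW' x).1 hl.left_mem, (hVW' y).1 hl.right_mem⟩
  -- Both degrees are twice the number of cycles of the class through the vertex, and `x` lies on
  -- `C' i` exactly when `x.1` lies on `C i`.
  · rw [← hF.2 x.1 ((hV x).1 hx),
      deg_unionIn P (not_isLink_completeMulti_self _ _) hle hdisj hC.1,
      deg_unionIn P (not_isLink_equipartite_self _ _ _) hle' hdisj' h.1.1]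
    simp only [h.mem_vertexSet_iff]

/-- The type of a `2`-regular union of cycles is multiplied by `m` under detaching. -/
theorem IsDetached.hasType_unionIn [Fintype ι]
    (hC : IsCycleDecomposition (completeMulti (lam * m) n) C) (h : IsDetached C C')
    {P : Set ι} {T : Multiset ℕ}
    (hF : IsRegular 2 (unionIn (completeMulti (lam * m) n) C P))
    (hT : HasType (unionIn (completeMulti (lam * m) n) C P) T) :
    HasType (unionIn (equipartite lam n m) C' P) (T.map fun x => m * x) := by
  obtain ⟨hle, hdisj⟩ := hC.le_and_disjoint
  obtain ⟨hle', -⟩ := h.1.le_and_disjoint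
  obtain ⟨t, c, H, rfl, hH, hHd, hFH⟩ := hT
  set F := unionIn (completeMulti (lam * m) n) C P with hFdef
  -- Degree 2 leaves room for only one cycle of the class at each vertex.
  have huniq : ∀ i ∈ P, ∀ j ∈ P, ∀ x, x ∈ V(C i) → x ∈ V(C j) → i = j := by
    intro i hi j hj x hxi hxj
    have h1 := hF x (mem_vertexSet_unionIn.2 ⟨i, hi, hxi⟩)
    rw [hFdef, deg_unionIn P (not_isLink_completeMulti_self _ _) hle hdisj hC.1] at h1
    obtain ⟨z, hz⟩ := Set.ncard_eq_one.1 (by omega : {i | i ∈ P ∧ x ∈ V(C i)}.ncard = 1)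
    have h2 : i ∈ ({z} : Set ι) := hz ▸ ⟨hi, hxi⟩
    have h3 : j ∈ ({z} : Set ι) := hz ▸ ⟨hj, hxj⟩
    exact h2.trans h3.symm
  have huniqH : ∀ a b x, x ∈ V(H a) → x ∈ V(H b) → a = b := by
    intro a b x ha hb
    by_contra hab
    exact Set.disjoint_left.1 (hHd hab) ha hb
  have hlinkH : ∀ e x y, F.IsLink e x y → ∃ a, (H a).IsLink e x y := by
    intro e x y hl
    rw [hFH] at hl
    obtain ⟨a, -, ha⟩ := hl.2
    exact ⟨a, ha⟩
  have hlinkC : ∀ e x y, F.IsLink e x y → ∃ i ∈ P, (C i).IsLink e x y :=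
    fun e x y hl => (unionIn_isLink hle).1 hl
  -- The cycles witnessing the type are not assumed to be members of `C`. Both families consist of
  -- disjoint connected pieces covering the edges of `F`, so pieces that meet have the same vertex
  -- set, and hence the same length.
  have hVeq : ∀ a, ∀ i ∈ P, ∀ x, x ∈ V(H a) → x ∈ V(C i) → V(C i) = V(H a) := by
    intro a i hi x hxa hxi
    apply Set.Subset.antisymm
    · intro y hy
      refine ((hC.1 i).iff_of_forall_isLink (P := fun y => y ∈ V(H a)) ?_ hxi hy).1 hxa
      intro e y z hl
      obtain ⟨b, hb⟩ := hlinkH e y z (hl.mono (le_unionIn hle hi))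
      constructor <;> intro hm
      · rw [huniqH a b y hm hb.left_mem]; exact hb.right_mem
      · rw [huniqH a b z hm hb.right_mem]; exact hb.left_mem
    · intro y hy
      refine (IsCycle.iff_of_forall_isLink ⟨_, (hH a).2⟩ (P := fun y => y ∈ V(C i)) ?_ hxa hy).1 hxi
      intro e y z hl
      obtain ⟨j, hj, hlj⟩ := hlinkC e y z (hl.mono (hH a).1)
      constructor <;> intro hm
      · rw [huniq i hi j hj y hm hlj.left_mem]; exact hlj.right_mem
      · rw [huniq i hi j hj z hm hlj.right_mem]; exact hlj.left_mem
  have hσ : ∀ a, ∃ i ∈ P, V(C i) = V(H a) := by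
    intro a
    obtain ⟨x, hx⟩ := IsCycle.vertexSet_nonempty ⟨_, (hH a).2⟩
    obtain ⟨i, hi, hxi⟩ := mem_vertexSet_unionIn.1 ((hH a).1.vertexSet_mono hx)
    exact ⟨i, hi, hVeq a i hi x hx hxi⟩
  choose σ hσP hσV using hσ
  have hmem : ∀ a x, x ∈ V(C' (σ a)) ↔ x.1 ∈ V(H a) := by
    intro a x
    rw [h.mem_vertexSet_iff, hσV]
  have hcover : ∀ x ∈ V(F), ∃ a, x ∈ V(H a) := by
    intro x hx
    rw [hFH] at hx
    obtain ⟨a, -, ha⟩ := mem_vertexSet_unionIn.1 hx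
    exact ⟨a, ha⟩
  have hcover' : ∀ i ∈ P, ∃ a, i = σ a := by
    intro i hi
    obtain ⟨x, hx⟩ := (hC.1 i).vertexSet_nonempty
    obtain ⟨a, ha⟩ := hcover x (mem_vertexSet_unionIn.2 ⟨i, hi, hx⟩)
    exact ⟨a, huniq i hi _ (hσP a) x hx (by rwa [hσV])⟩
  have hσle : ∀ a, C' (σ a) ≤ unionIn (equipartite lam n m) C' P :=
    fun a => le_unionIn hle' (hσP a)
  refine ⟨t, fun a => m * c a, fun a => C' (σ a), by rw [Multiset.map_map]; rfl, fun a => ⟨hσle a, ?_⟩,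
    fun a b hab => ?_, Graph.ext ?_ ?_⟩
  · have h1 := (hC.1 (σ a)).isCycleOfLength
    rw [hσV, (hH a).2.ncard_vertexSet] at h1
    beta_reduce
    rw [mul_comm]
    exact h.isCycleOfLength h1
  · beta_reduce
    rw [Set.disjoint_left]
    intro x hx hx'
    exact Set.disjoint_left.1 (hHd hab) ((hmem a x).1 hx) ((hmem b x).1 hx')
  · ext x
    simp only [mem_vertexSet_unionIn, Set.mem_univ, true_and]
    constructor
    · rintro ⟨i, hi, hx⟩
      obtain ⟨a, rfl⟩ := hcover' i hi
      exact ⟨a, hx⟩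
    · rintro ⟨a, hx⟩
      exact ⟨σ a, hσP a, hx⟩
  · intro e x y
    rw [unionIn_isLink hσle, unionIn_isLink hle']
    simp only [Set.mem_univ, true_and]
    constructor
    · rintro ⟨i, hi, hx⟩
      obtain ⟨a, rfl⟩ := hcover' i hi
      exact ⟨a, hx⟩
    · rintro ⟨a, hx⟩
      exact ⟨σ a, hσP a, hx⟩

theorem IsDetached.isResolvable [Fintype ι]
    (hC : IsCycleDecomposition (completeMulti (lam * m) n) C) (h : IsDetached C C')
    {l : ℕ} {a : Fin l → ℕ} (hR : IsResolvable (completeMulti (lam * m) n) C a) :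
    IsResolvable (equipartite lam n m) C' a := by
  obtain ⟨p, hp⟩ := hR
  refine ⟨p, fun j => ?_⟩
  have h1 := h.isFactor_unionIn hC (r := 2 * a j) (W := ∅) (P := {i | p i = j})
    (by rw [Graph.deleteVerts_empty]; exact hp j)
  simpa using h1

theorem IsDetached.exists_twoFactorization [Fintype ι] (hn : 0 < n) (hm : 0 < m)
    (hC : IsCycleDecomposition (completeMulti (lam * m) n) C) (h : IsDetached C C')
    {l : ℕ} {T : Fin l → Multiset ℕ} {F : Fin l → Graph (Fin n) (Sym2 (Fin n) × Fin (lam * m))}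
    (hF : IsTwoFactorizationOfType (completeMulti (lam * m) n) F T)
    (hCF : CorrespondsTo (completeMulti (lam * m) n) C F) :
    ∃ F', IsTwoFactorizationOfType (equipartite lam n m) F'
        (fun s => (T s).map (fun x => m * x)) ∧
      CorrespondsTo (equipartite lam n m) C' F' := by
  obtain ⟨p, hp⟩ := hCF
  obtain rfl : F = fun s => unionIn (completeMulti (lam * m) n) C {i | p i = s} := funext hp
  refine ⟨fun s => unionIn (equipartite lam n m) C' {i | p i = s}, ⟨fun s => ⟨?_, ?_⟩, ?_⟩,
    p, fun s => rfl⟩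
  · have h1 := h.isFactor_unionIn hC (r := 2) (W := ∅) (P := {i | p i = s})
      (by rw [Graph.deleteVerts_empty]; exact (hF.1 s).1)
    simpa using h1
  · exact h.hasType_unionIn hC (hF.1 s).1.2 (hF.1 s).2
  · rcases h.1.2 with hD | ⟨hodd, hD⟩
    · exact .inl (hD.unionIn_fibers p)
    · refine .inr ⟨⟨(n - 1) * (lam * m), ?_, fun x _ => deg_equipartite lam n m x⟩,
        hD.unionIn_fibers p⟩
      rw [← deg_equipartite lam n m (⟨0, hn⟩, ⟨0, hm⟩)]
      exact hodd _ (Set.mem_univ _)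

theorem IsDetached.exists_holeyTwoFactorization [Fintype ι] (hn : 0 < n) (hm : 0 < m)
    (hC : IsCycleDecomposition (completeMulti (lam * m) n) C) (h : IsDetached C C')
    {l : ℕ} {T : Fin l → Multiset ℕ} {F : Fin l → Graph (Fin n) (Sym2 (Fin n) × Fin (lam * m))}
    (hF : IsAlmostTwoFactorizationOfType (completeMulti (lam * m) n) F T)
    (hCF : CorrespondsTo (completeMulti (lam * m) n) C F) :
    ∃ F', IsHoleyTwoFactorizationOfType lam n m F'
        (fun s => (T s).map (fun x => m * x)) ∧
      CorrespondsTo (equipartite lam n m) C' F' := by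
  obtain ⟨p, hp⟩ := hCF
  obtain rfl : F = fun s => unionIn (completeMulti (lam * m) n) C {i | p i = s} := funext hp
  refine ⟨fun s => unionIn (equipartite lam n m) C' {i | p i = s}, ⟨fun s => ⟨?_, ?_⟩, ?_⟩,
    p, fun s => rfl⟩
  · obtain ⟨v, -, hv⟩ := (hF.1 s).1
    exact ⟨v, h.isFactor_unionIn hC hv⟩
  · obtain ⟨v, -, hv⟩ := (hF.1 s).1
    exact h.hasType_unionIn hC hv.2 (hF.1 s).2
  · rcases h.1.2 with hD | ⟨hodd, -⟩
    · exact hD.unionIn_fibers p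
    -- An almost 2-factorization uses no 1-factor and makes every degree of λmK_n even, while the
    -- alternative for `C'` would make the same number odd.
    · exfalso
      obtain ⟨hle, hdisj⟩ := hC.le_and_disjoint
      have h1 : Odd ((n - 1) * (lam * m)) := by
        rw [← deg_equipartite lam n m (⟨0, hn⟩, ⟨0, hm⟩)]
        exact hodd _ (Set.mem_univ _)
      rw [← deg_completeMulti (lam * m) n ⟨0, hn⟩,
        hF.2.deg_eq_sum (not_isLink_completeMulti_self _ _)] at h1
      refine Nat.not_even_iff_odd.2 h1 (Finset.even_sum _ fun s _ => ?_)
      rw [deg_unionIn _ (not_isLink_completeMulti_self _ _) hle hdisj hC.1]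
      exact even_two_mul _

end Transfer

/-! ### From dart systems to graph decompositions and back -/

/-- A fully detached dart system realises a decomposition of the equipartite multigraph into its
colour classes; connected `2`-regular classes are cycles. -/
theorem IsAmalgamation.exists_decomposition {D J : Type*} [Fintype D] [DecidableEq D]
    [DecidableEq J] {lam n m : ℕ} {rev : D → D} {c : D → J} {δ : J → Fin n → ℕ} {Z : Set J}
    {h : D → Fin n × Fin m}
    (H : IsAmalgamation (X := Fin n × Fin m) Prod.fst rev c lam δ Z (fun _ => 1) h)
    (hrev : rev.Involutive) (hc : ∀ d, c (rev d) = c d) (hlam : 0 < lam)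
    (U : J → Set (Fin n)) (hU : ∀ j v, v ∉ U j → δ j v = 0) :
    ∃ K : J → Graph (Fin n × Fin m) (Sym2 (Fin n × Fin m) × Fin lam),
      IsDecomposition (equipartite lam n m) K ∧ (∀ j, V(K j) = {x | x.1 ∈ U j}) ∧
      (∀ j x, deg (K j) x = δ j x.1) ∧
      ∀ j ∈ Z, (∃ x : Fin n × Fin m, x.1 ∈ U j) → (∀ v ∈ U j, δ j v = 2) → IsCycle (K j) := by
  classical
  obtain ⟨t, htrev, htinj, htsurj⟩ := exists_dart_labels (π := Prod.fst) hrev H.ne hlam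
    (fun x y hxy => by rw [H.mult x y hxy, mul_one, mul_one])
  have hdeg : ∀ j x, (Finset.univ.filter fun d => c d = j ∧ h d = x).card = δ j x.1 :=
    fun j x => by rw [H.degree, mul_one]
  have hloop : ∀ d, h d ≠ h (rev d) := fun d e => H.ne d (congrArg Prod.fst e)
  -- The edge underlying a dart; its fibres are the pairs of mutually reverse darts.
  set Φ : D → Sym2 (Fin n × Fin m) × Fin lam := fun d => (s(h d, h (rev d)), t d) with hΦ
  have hΦrev : ∀ d, Φ (rev d) = Φ d := by
    intro d
    simp only [hΦ, hrev d, htrev, Sym2.eq_swap]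
  have hΦinj : ∀ d d', Φ d = Φ d' → d' = d ∨ d' = rev d := by
    intro d d' e
    rw [hΦ, Prod.mk.injEq] at e
    exact htinj d d' e.1 e.2
  have hmemU : ∀ d, (h d).1 ∈ U (c d) := by
    intro d
    by_contra hd
    have h1 := hdeg (c d) (h d)
    rw [hU _ _ hd, Finset.card_eq_zero] at h1
    exact Finset.notMem_empty d (h1 ▸ by simp)
  -- Inducing on the prescribed set fixes the vertex set, including any isolated vertices, and loses
  -- no edge of the colour because of `hmemU`.
  set K : J → Graph (Fin n × Fin m) (Sym2 (Fin n × Fin m) × Fin lam) := fun j =>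
    ((equipartite lam n m).restrict (Φ '' {d | c d = j})).induce {x | x.1 ∈ U j} with hK
  have hKV : ∀ j, V(K j) = {x | x.1 ∈ U j} := fun j => rfl
  have hKl : ∀ j e x y, (K j).IsLink e x y ↔
      ∃ d, c d = j ∧ Φ d = e ∧ h d = x ∧ h (rev d) = y := by
    intro j e x y
    constructor
    · rintro ⟨⟨⟨d, hd, rfl⟩, -, hs⟩, -, -⟩
      rcases Sym2.eq_iff.1 hs with ⟨h1, h2⟩ | ⟨h1, h2⟩
      · exact ⟨d, hd, rfl, h1, h2⟩
      · exact ⟨rev d, (hc d).trans hd, hΦrev d, h2, by rw [hrev]; exact h1⟩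
    · rintro ⟨d, rfl, rfl, rfl, rfl⟩
      refine ⟨⟨⟨d, rfl, rfl⟩, H.ne d, rfl⟩, hmemU d, ?_⟩
      have := hmemU (rev d)
      rwa [hc] at this
  have hKE : ∀ j e, e ∈ E(K j) ↔ ∃ d, c d = j ∧ Φ d = e := by
    intro j e
    rw [Graph.edge_mem_iff_exists_isLink]
    constructor
    · rintro ⟨x, y, hl⟩
      obtain ⟨d, h1, h2, -⟩ := (hKl j e x y).1 hl
      exact ⟨d, h1, h2⟩
    · rintro ⟨d, h1, h2⟩
      exact ⟨_, _, (hKl j e _ _).2 ⟨d, h1, h2, rfl, rfl⟩⟩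
  have hKle : ∀ j, K j ≤ equipartite lam n m := fun j =>
    (Graph.induce_le (Set.subset_univ _)).trans Graph.restrict_le
  refine ⟨K, ⟨hKle, ?_, ?_⟩, hKV, ?_, ?_⟩
  · intro j j' hj
    rw [Set.disjoint_left]
    intro e he he'
    obtain ⟨d, h1, h2⟩ := (hKE j e).1 he
    obtain ⟨d', h1', h2'⟩ := (hKE j' e).1 he'
    apply hj
    rw [← h1, ← h1']
    rcases hΦinj d d' (h2.trans h2'.symm) with e | e
    · rw [e]
    · rw [e, hc]
  · apply Set.Subset.antisymm
    · intro e he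
      obtain ⟨x, y, hxy, hs⟩ := Graph.exists_isLink_of_mem_edgeSet he
      obtain ⟨d, h1, h2, h3⟩ := htsurj x y hxy e.2
      refine Set.mem_iUnion.2 ⟨c d, (hKE _ _).2 ⟨d, rfl, ?_⟩⟩
      simp only [hΦ, h1, h2, h3, ← hs]
    · exact Set.iUnion_subset fun j => (hKle j).edgeSet_mono
  · intro j x
    rw [deg_eq_ncard_incidenceSet fun e x hl => not_isLink_equipartite_self _ _ _ e x
      (hl.mono (hKle j)), ← hdeg j x, ← Set.ncard_coe_finset,
      ← Set.InjOn.ncard_image (f := Φ)]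
    · congr 1
      ext e
      simp only [Graph.mem_incidenceSet, Graph.Inc, hKl, Finset.coe_filter, Finset.mem_univ,
        true_and, Set.mem_image, Set.mem_ofPred_eq]
      constructor
      · rintro ⟨y, d, h1, h2, h3, -⟩
        exact ⟨d, ⟨h1, h3⟩, h2⟩
      · rintro ⟨d, ⟨h1, h3⟩, h2⟩
        exact ⟨_, d, h1, h2, h3, rfl⟩
    · intro d hd d' hd' e
      simp only [Finset.coe_filter, Finset.mem_univ, true_and, Set.mem_ofPred_eq] at hd hd'
      rcases hΦinj d d' e with e | e
      · exact e.symm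
      · exact absurd (hd.2.trans (by rw [← e, hd'.2])) (hloop d)
  · intro j hj ⟨x₀, hx₀⟩ hδ
    have hcard : ∀ d, c d = j → (Finset.univ.filter fun d' => c d' = j ∧ h d' = h d).card = 2 := by
      rintro d rfl
      rw [hdeg, hδ _ (hmemU d)]
    obtain ⟨d₀, hd₀⟩ : (Finset.univ.filter fun d => c d = j ∧ h d = x₀).Nonempty := by
      rw [← Finset.card_pos, hdeg, hδ _ hx₀]; omega
    obtain ⟨l, f, hl, hfC, hfinj, hfs, hfne, -, hfcl⟩ := exists_cyclic_darts (C := fun d => c d = j)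
      hrev (fun d hd => (hc d).trans hd) hloop
      (fun d hd => by
        obtain ⟨d', h1, h2⟩ := Finset.exists_mem_ne (by rw [hcard d hd]; omega) d
        simp only [Finset.mem_filter, Finset.mem_univ, true_and] at h1
        exact ⟨d', h1.1, h1.2, h2⟩)
      (fun d₁ d₂ d₃ h1 h2 h3 h12 h13 => by
        by_contra hcon
        push Not at hcon
        have := hcard d₁ h1
        have h4 : 2 < (Finset.univ.filter fun d' => c d' = j ∧ h d' = h d₁).card :=
          Finset.two_lt_card.2 ⟨d₁, by simp [h1], d₂, by simp [h2, h12], d₃, by simp [h3, h13],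
            hcon.1, hcon.2.1, hcon.2.2⟩
        omega)
      (Finset.mem_filter.1 hd₀).2.1
    have hstep : ∀ d, c d = j → h d ∈ Set.range (fun i => h (f i)) →
        h (rev d) ∈ Set.range fun i => h (f i) := by
      rintro d hd ⟨i, hi⟩
      obtain ⟨i', rfl | rfl⟩ := hfcl d hd i hi.symm
      · exact ⟨i' + 1, (hfs i').symm⟩
      · exact ⟨i', by rw [hrev]⟩
    -- The vertices of the traced cycle are closed under darts of colour `j`, so connectedness of
    -- the colour class makes them all of the prescribed set.
    have hVr : ∀ x : Fin n × Fin m, x.1 ∈ U j → x ∈ Set.range fun i => h (f i) := by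
      intro x hx
      have h0 : (h (f 0)).1 ∈ U j := by
        have := hmemU (f 0)
        rwa [hfC] at this
      refine (H.connected j hj (fun y => y ∈ Set.range fun i => h (f i)) ?_ x (h (f 0))
        (by rw [hδ _ hx]; omega) (by rw [hδ _ h0]; omega) one_ne_zero one_ne_zero).2 ⟨0, rfl⟩
      intro d hd
      refine ⟨hstep d hd, fun hr => ?_⟩
      have := hstep (rev d) ((hc d).trans hd) hr
      rwa [hrev] at this
    refine ⟨l, hl, fun i => h (f i), fun i => Φ (f i), hfinj, ?_, ?_, ?_, ?_⟩
    · intro i i' e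
      rcases hΦinj _ _ e with e | e
      · exact hfinj (by simp only [e])
      · have h1 : i' = i + 1 := hfinj (by simp only [e, hfs])
        rw [h1] at e
        exact absurd e (hfne i)
    · rw [hKV]
      apply Set.Subset.antisymm
      · exact fun x hx => hVr x hx
      · rintro _ ⟨i, rfl⟩
        have := hmemU (f i)
        rwa [hfC] at this
    · ext e
      rw [hKE]
      constructor
      · rintro ⟨d, hd, rfl⟩
        have h1 := hmemU d
        rw [hd] at h1
        obtain ⟨i, hi⟩ := hVr _ h1
        obtain ⟨i', rfl | rfl⟩ := hfcl d hd i hi.symm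
        · exact ⟨i', rfl⟩
        · exact ⟨i', (hΦrev _).symm⟩
      · rintro ⟨i, rfl⟩
        exact ⟨f i, hfC i, rfl⟩
    · intro i
      exact (hKl _ _ _ _).2 ⟨f i, hfC i, rfl, rfl, hfs i⟩

/-- The graph obtained from a decomposition of `lam m K_n` by replacing each edge by `m` parallel
edges is an amalgamation of `lam K_{n × m}`, and detaching it yields a decomposition of
`lam K_{n × m}` in which cycles are replaced by cycles. -/
theorem exists_detached_decomposition {J : Type*} [Fintype J] {lam n m : ℕ} (hlam : 0 < lam)
    (hm : 0 < m) {A : J → Graph (Fin n) (Sym2 (Fin n) × Fin (lam * m))}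
    (hA : IsDecomposition (completeMulti (lam * m) n) A) :
    ∃ K : J → Graph (Fin n × Fin m) (Sym2 (Fin n × Fin m) × Fin lam),
      IsDecomposition (equipartite lam n m) K ∧ (∀ j, V(K j) = {x | x.1 ∈ V(A j)}) ∧
      (∀ j x, deg (K j) x = deg (A j) x.1) ∧ ∀ j, IsCycle (A j) → IsCycle (K j) := by
  classical
  -- A dart is an oriented edge of λmK_n together with the index of one of its `m` copies. Between
  -- two vertices this gives λm·m darts in each direction, as required for weights `m` and `m`.
  let D := {d : (Fin n × Fin n) × (Fin (lam * m) × Fin m) // d.1.1 ≠ d.1.2}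
  let rev : D → D := fun d => ⟨((d.1.1.2, d.1.1.1), d.1.2), d.2.symm⟩
  have hrev : rev.Involutive := fun d => rfl
  let ed : D → Sym2 (Fin n) × Fin (lam * m) := fun d => (s(d.1.1.1, d.1.1.2), d.1.2.1)
  have hedrev : ∀ d, ed (rev d) = ed d := fun d => by simp only [ed, rev, Sym2.eq_swap]
  have hedl : ∀ d, (completeMulti (lam * m) n).IsLink (ed d) d.1.1.1 d.1.1.2 :=
    fun d => ⟨d.2, rfl⟩
  have hcol : ∀ d, ∃ j, ed d ∈ E(A j) := by
    intro d
    have := (hedl d).edge_mem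
    rw [hA.2.2] at this
    exact Set.mem_iUnion.1 this
  choose c hcE using hcol
  have hcu : ∀ d j, c d = j ↔ ed d ∈ E(A j) := by
    refine fun d j => ⟨fun e => e ▸ hcE d, fun hj => ?_⟩
    by_contra hne
    exact Set.disjoint_left.1 (hA.2.1 hne) (hcE d) hj
  have hc : ∀ d, c (rev d) = c d := fun d => (hcu _ _).2 (by rw [hedrev]; exact hcE d)
  have hAloop : ∀ j e x, ¬ (A j).IsLink e x x := fun j e x hl =>
    not_isLink_completeMulti_self _ _ e x (hl.mono (hA.1 j))
  let z : Fin m := ⟨0, hm⟩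
  -- Initially all the weight of a part sits on its vertex indexed by `z`; the other vertices are
  -- empty places to be filled by splitting.
  have H : IsAmalgamation (X := Fin n × Fin m) Prod.fst rev c lam (fun j v => deg (A j) v)
      {j | IsCycle (A j)} (fun x => if x.2 = z then m else 0) (fun d => (d.1.1.1, z)) := by
    refine ⟨fun d => d.2, ?_, ?_, ?_⟩
    · rintro ⟨x, i⟩ ⟨y, i'⟩ hxy
      by_cases hi : i = z
      · by_cases hi' : i' = z
        · subst hi hi'
          rw [if_pos rfl]
          have h1 : (Finset.univ : Finset (Fin (lam * m) × Fin m)).card = lam * m * m := by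
            simp
          rw [← h1]
          refine Finset.card_bij' (fun d _ => d.1.2) (fun p _ => ⟨((x, y), p), hxy⟩)
            (fun _ _ => Finset.mem_univ _) ?_ ?_ (fun _ _ => rfl)
          · intro p _
            simp [rev, z]
          · rintro ⟨⟨⟨a, b⟩, p⟩, hd⟩ hm'
            simp only [Finset.mem_filter, Finset.mem_univ, true_and, rev, Prod.mk.injEq] at hm'
            obtain ⟨⟨rfl, -⟩, ⟨rfl, -⟩⟩ := hm'
            rfl
        · rw [if_neg hi', mul_zero, Finset.card_eq_zero, Finset.filter_eq_empty_iff]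
          intro d _ hd
          exact hi' (congrArg Prod.snd hd.2).symm
      · rw [if_neg hi, mul_zero, zero_mul, Finset.card_eq_zero, Finset.filter_eq_empty_iff]
        intro d _ hd
        exact hi (congrArg Prod.snd hd.1).symm
    · rintro j ⟨x, i⟩
      by_cases hi : i = z
      · subst hi
        rw [if_pos rfl, deg_eq_ncard_incidenceSet (hAloop j), Set.ncard_eq_toFinset_card']
        have h1 : (((A j).incidenceSet x).toFinset ×ˢ (Finset.univ : Finset (Fin m))).card
            = ((A j).incidenceSet x).toFinset.card * m := by
          rw [Finset.card_product, Finset.card_univ, Fintype.card_fin]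
        rw [← h1]
        refine Finset.card_bij (fun d _ => (ed d, d.1.2.2)) ?_ ?_ ?_
        · intro d hd
          simp only [Finset.mem_filter, Finset.mem_univ, true_and, Prod.mk.injEq] at hd
          simp only [Finset.mem_product, Set.mem_toFinset, Finset.mem_univ, and_true,
            Graph.mem_incidenceSet]
          rw [(hA.1 j).inc_congr ((hcu d j).1 hd.1), ← hd.2.1]
          exact (hedl d).inc_left
        · rintro ⟨⟨⟨a, b⟩, p, q⟩, hd⟩ hm₁ ⟨⟨⟨a', b'⟩, p', q'⟩, hd'⟩ hm₂ e
          simp only [Finset.mem_filter, Finset.mem_univ, true_and, Prod.mk.injEq] at hm₁ hm₂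
          obtain rfl : a = x := hm₁.2.1
          obtain rfl : a' = a := hm₂.2.1
          simp only [ed, Prod.mk.injEq, Sym2.congr_right] at e
          obtain ⟨⟨rfl, rfl⟩, rfl⟩ := e
          rfl
        · rintro ⟨⟨e, p⟩, q⟩ he
          simp only [Finset.mem_product, Set.mem_toFinset, Finset.mem_univ, and_true,
            Graph.mem_incidenceSet] at he
          obtain ⟨y, hl⟩ := he
          obtain ⟨hxy, rfl⟩ := hl.mono (hA.1 j)
          refine ⟨⟨((x, y), (p, q)), hxy⟩, ?_, rfl⟩
          simp only [Finset.mem_filter, Finset.mem_univ, true_and, and_true]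
          exact (hcu _ _).2 hl.edge_mem
      · rw [if_neg hi, mul_zero, Finset.card_eq_zero, Finset.filter_eq_empty_iff]
        intro d _ hd
        exact hi (congrArg Prod.snd hd.2).symm
    · rintro j hj P hP ⟨x, i⟩ ⟨y, i'⟩ hx hy hi hi'
      obtain rfl : i = z := by
        by_contra hne
        exact hi (if_neg hne)
      obtain rfl : i' = z := by
        by_contra hne
        exact hi' (if_neg hne)
      refine IsCycle.iff_of_forall_isLink hj (P := fun v => P (v, z)) ?_
        (by_contra fun hn => hx (deg_eq_zero_of_notMem hn))
        (by_contra fun hn => hy (deg_eq_zero_of_notMem hn))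
      rintro ⟨e, p⟩ a b hl
      obtain ⟨hab, rfl⟩ := hl.mono (hA.1 j)
      exact hP ⟨((a, b), (p, z)), hab⟩ ((hcu _ _).2 hl.edge_mem)
  obtain ⟨h', -, H'⟩ := H.exists_detachment hrev hc (by
    intro j hj v
    by_cases hv : v ∈ V(A j)
    · rw [IsCycle.deg_eq_two hj hv]; exact even_two
    · rw [deg_eq_zero_of_notMem hv]; exact Even.zero) (by
    intro v
    rw [Finset.card_filter, Finset.sum_filter, Fintype.sum_prod_type, Fintype.sum_prod_type,
      Finset.sum_eq_single v (by simp +contextual) (by simp),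
      Finset.sum_eq_single v (by simp +contextual) (by simp)]
    simp)
  obtain ⟨K, hK, hKV, hKdeg, hKcyc⟩ := H'.exists_decomposition hrev hc hlam (fun j => V(A j))
    (fun j v hv => deg_eq_zero_of_notMem hv)
  refine ⟨K, hK, hKV, hKdeg, fun j hj => hKcyc j hj ?_ fun v hv => IsCycle.deg_eq_two hj hv⟩
  obtain ⟨x, hx⟩ := hj.vertexSet_nonempty
  exact ⟨(x, z), hx⟩

/-- In the odd case the 1-factor travels along as the extra colour `none`. Nothing about its
connectedness is needed: preserved degrees and a full vertex set make it a 1-factor again. -/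
theorem exists_isDetached {lam n m : ℕ} {ι : Type*} [Fintype ι] (hlam : 0 < lam) (hm : 0 < m)
    {C : ι → Graph (Fin n) (Sym2 (Fin n) × Fin (lam * m))}
    (hC : IsCycleDecomposition (completeMulti (lam * m) n) C) :
    ∃ C' : ι → Graph (Fin n × Fin m) (Sym2 (Fin n × Fin m) × Fin lam), IsDetached C C' := by
  rcases hC.2 with hD | ⟨hodd, I, hI, hD⟩
  · obtain ⟨K, hK, hKV, -, hKc⟩ := exists_detached_decomposition hlam hm hD
    refine ⟨K, ⟨fun i => hKc i (hC.1 i), .inl hK⟩, fun i => ?_⟩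
    rw [hKV]
    ext x
    simp [part]
  · obtain ⟨K, hK, hKV, hKd, hKc⟩ := exists_detached_decomposition hlam hm hD
    refine ⟨fun i => K (some i), ⟨fun i => hKc (some i) (hC.1 i), .inr ⟨fun x _ => ?_, K none,
      ⟨⟨hK.1 none, ?_⟩, fun x _ => ?_⟩, ?_⟩⟩, fun i => ?_⟩
    · rw [deg_equipartite, ← deg_completeMulti (lam * m) n x.1]
      exact hodd _ (Set.mem_univ _)
    · have h1 : V(I) = Set.univ := hI.1.vertexSet_eq
      rw [hKV]
      ext x
      simp only [Option.elim, h1]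
      exact iff_of_true (Set.mem_univ _) (Set.mem_univ _)
    · rw [hKd]
      exact hI.2 _ (hI.1.vertexSet_eq ▸ Set.mem_univ _)
    · convert hK using 1
      funext o
      cases o <;> rfl
    · rw [hKV]
      ext x
      simp [part]

end CycleDecomp

theorem mainTheorem2 (lam n m k : ℕ) (hlam : 0 < lam) (hn : 0 < n) (hm : 0 < m)
    (C : Fin k → Graph (Fin n) (Sym2 (Fin n) × Fin (lam * m)))
    (hC : IsCycleDecomposition (completeMulti (lam * m) n) C) :
    (∃ C' : Fin k → Graph (Fin n × Fin m) (Sym2 (Fin n × Fin m) × Fin lam), IsDetached C C') ∧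
    ∀ C' : Fin k → Graph (Fin n × Fin m) (Sym2 (Fin n × Fin m) × Fin lam), IsDetached C C' →
      (∀ c : Fin k → ℕ,
        IsCycleDecompositionOfLengths (completeMulti (lam * m) n) C c →
        IsCycleDecompositionOfLengths (equipartite lam n m) C' (fun i => c i * m)) ∧
      (∀ (l : ℕ) (a : Fin l → ℕ),
        IsResolvable (completeMulti (lam * m) n) C a →
        IsResolvable (equipartite lam n m) C' a) ∧
      (∀ (l : ℕ) (T : Fin l → Multiset ℕ),
        (∃ F, IsTwoFactorizationOfType (completeMulti (lam * m) n) F T ∧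
          CorrespondsTo (completeMulti (lam * m) n) C F) →
        ∃ F', IsTwoFactorizationOfType (equipartite lam n m) F'
            (fun s => (T s).map (fun x => m * x)) ∧
          CorrespondsTo (equipartite lam n m) C' F') ∧
      (∀ (l : ℕ) (T : Fin l → Multiset ℕ),
        (∃ F, IsAlmostTwoFactorizationOfType (completeMulti (lam * m) n) F T ∧
          CorrespondsTo (completeMulti (lam * m) n) C F) →
        ∃ F', IsHoleyTwoFactorizationOfType lam n m F'
            (fun s => (T s).map (fun x => m * x)) ∧
          CorrespondsTo (equipartite lam n m) C' F') := by
  refine ⟨exists_isDetached hlam hm hC, fun C' h => ⟨fun c hc => ⟨h.1, fun i =>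
    h.isCycleOfLength (hc.2 i)⟩, fun l a hR => h.isResolvable hC hR, ?_, ?_⟩⟩
  · rintro l T ⟨F, hF, hCF⟩
    exact h.exists_twoFactorization hn hm hC hF hCF
  · rintro l T ⟨F, hF, hCF⟩
    exact h.exists_holeyTwoFactorization hn hm hC hF hCF
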